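/- Let $(\Sigma,q)$ be a smooth oriented Riemannian $3$-manifold with a dreibein $e$, i.e. a smooth global section $(e_1,e_2,e_3)$ of its bundle of oriented orthonormal frames, with dual coframe $(e^1,e^2,e^3)$ and Riemannian volume form $\mathrm{Vol}_q$. Let $\tau_1,\tau_2,\tau_3$ be the basis of $\mathfrak{su}(2)$ with $[\tau_b,\tau_c]=\epsilon^a{}_{bc}\tau_a$, and let $A=A^a\otimes\tau_a$ be an Ashtekar connection in the gauge $e$, i.e. a smooth $\mathfrak{su}(2)$-valued $1$-form on $\Sigma$. Let $D$ be the metric covariant derivative on $\mathrm T\Sigma$ it induces, $De_a=A^b\epsilon_{ba}{}^{c}e_c$. Write its curvature as $F=dA+\tfrac12[A\wedge A]=\tfrac12F^a\otimes\tau_a$, so that in coordinates $F^a=F^a_{ij}\,dx^i\wedge dx^j$ (sum over all $i,j$) with $F^a_{ij}=\partial_iA^a_j-\partial_jA^a_i+\epsilon^a{}_{bc}A^b_iA^c_j$. Let $\nabla$ be the Levi-Civita connection of $q$, with $\nabla e_a=\Gamma^c\epsilon_{ca}{}^{b}e_b$. Fix real numbers $\beta\neq0$ and $k\neq0$, write $A^a=\Gamma^a+\beta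 K^a$, and let $W=K^a\otimes e_a\in\operatorname{End}(\mathrm T\Sigma)$ be the reconstructed Weingarten map, $W(\partial_i)=W_i^{\,j}\partial_j$, and $K_{ij}=q(W(\partial_i),\partial_j)$. Let $$G_a=\operatorname{tr}(X\mapsto(\nabla-D)_Xe_a)\,\mathrm{Vol}_q$$ be the Gauss constraint, and define the section of $\Lambda^3\mathrm T^*\Sigma\otimes\mathrm T^*\Sigma$ $$\mathcal V=\tfrac12\,\epsilon_{abc}\,\langle F^b,\star e^c\rangle_{\Lambda^2}\,\mathrm{Vol}_q\otimes e^a ,$$ where $\star$ is the Hodge star and $\langle\cdot,\cdot\rangle_{\Lambda^2}$ the inner product on $2$-forms induced by $q$ (for which the $e^a\wedge e^b$, $a<b$, are orthonormal). Then: 1. $\mathcal V$ is the diffeomorphism constraint: in every positively oriented coordinate system, with $E^j_b=\sqrt q\,e^j_b$, $$\mathcal V(\partial_i)=E^j_bF^b_{ij}\;dx^1\wedge dx^2\wedge dx^3 .$$ 2. If $D$ is torsion-free, then $\mathcal V=0$. 3. If $G_a=0$ on $\Sigma$ for $a=1,2,3$, then at every point $x\in\Sigma$ and in every coordinate system around $x$,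 the following are equivalent: (i) $\mathcal V=0$ at $x$; (ii) the contracted Codazzi equation (in a Ricci-flat spacetime) for $(q,W)$ holds at $x$, i.e. for all $i$ $$\partial_iW_j^{\,j}-\partial_jW_i^{\,j}+\Gamma^j_{il}W_j^{\,l}-\Gamma^j_{jl}W_i^{\,l}=0,$$ where $\Gamma^j_{il}$ are the Christoffel symbols of $q$; (iii) the ADM supermomentum constraint holds at $x$, i.e. for all $i$ $$H_i=-2q_{ij}\nabla_lP^{lj}=0,\qquad P^{ij}=\tfrac{\sqrt q}{k}\bigl(K^{ij}-q^{ij}K^l_{\,l}\bigr),$$ where $\nabla_l P^{lj}$ is the covariant divergence of a tensor density of weight one and indices are raised with $q$. -/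

import Mathlib

open scoped Manifold ContDiff Bundle InnerProductSpace
open Module Bundle

noncomputable section

namespace Ashtekar

/-- The model space `ℝ³`. -/
abbrev E3 : Type := EuclideanSpace ℝ (Fin 3)

/-- The model with corners of a boundaryless 3-manifold. -/
abbrev I3 : ModelWithCorners ℝ E3 E3 := 𝓘(ℝ, E3)

/-- The totally antisymmetric symbol, `ε₀₁₂ = 1`. -/
def eps (a b c : Fin 3) : ℝ :=
  (((b : ℕ) : ℝ) - ((a : ℕ) : ℝ)) * (((c : ℕ) : ℝ) - ((a : ℕ) : ℝ)) *
    (((c : ℕ) : ℝ) - ((b : ℕ) : ℝ)) / 2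

/-! ### The Lie algebra `su(2)` -/

/-- `su(2)`: skew-Hermitian traceless complex `2 × 2` matrices. -/
def su2 : Submodule ℝ (Matrix (Fin 2) (Fin 2) ℂ) where
  carrier := {X | X.conjTranspose = -X ∧ X.trace = 0}
  add_mem' := by
    rintro X Y ⟨hX, hX'⟩ ⟨hY, hY'⟩
    refine ⟨?_, ?_⟩
    · rw [Matrix.conjTranspose_add, hX, hY, neg_add]
    · rw [Matrix.trace_add, hX', hY', add_zero]
  zero_mem' := by simp
  smul_mem' := by
    rintro c X ⟨hX, hX'⟩
    refine ⟨?_, ?_⟩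
    · rw [Matrix.conjTranspose_smul, hX, star_trivial, smul_neg]
    · rw [Matrix.trace_smul, hX', smul_zero]

/-- The commutator bracket of `su(2)`. -/
def su2Bracket (X Y : su2) : su2 :=
  ⟨X.1 * Y.1 - Y.1 * X.1, by
    have hX : X.1.conjTranspose = -X.1 := X.2.1
    have hY : Y.1.conjTranspose = -Y.1 := Y.2.1
    refine ⟨?_, ?_⟩
    · rw [Matrix.conjTranspose_sub, Matrix.conjTranspose_mul, Matrix.conjTranspose_mul, hX, hY]
      simp
    · rw [Matrix.trace_sub, Matrix.trace_mul_comm, sub_self]⟩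

/-- The Pauli matrices. -/
def pauli : Fin 3 → Matrix (Fin 2) (Fin 2) ℂ :=
  ![!![0, 1; 1, 0], !![0, -Complex.I; Complex.I, 0], !![1, 0; 0, -1]]

/-- The basis `τ_a = -(i/2) σ_a` of `su(2)`. -/
def tau (a : Fin 3) : su2 :=
  ⟨(-Complex.I / 2) • pauli a, by
    constructor
    · ext i j
      fin_cases a <;> fin_cases i <;> fin_cases j <;> simp [pauli, Matrix.conjTranspose_apply] <;> ring
    · fin_cases a <;> simp [pauli, Matrix.trace_fin_two]⟩

/-- The coordinates `X ↦ X^a = -2 Re tr (X τ_a)` of `su(2)` in the basis `τ_a`. -/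
def su2Coord (a : Fin 3) : su2 →L[ℝ] ℝ where
  toFun X := -2 * (Matrix.trace (X.1 * (tau a).1)).re
  map_add' X Y := by
    simp [add_mul, Matrix.trace_add, mul_add]
  map_smul' c X := by
    simp [Matrix.trace_smul]
    ring
  cont := by fun_prop

theorem su2Coord_tau (a b : Fin 3) : su2Coord a (tau b) = if a = b then 1 else 0 := by
  fin_cases a <;> fin_cases b <;>
    simp [su2Coord, tau, pauli, Matrix.trace_fin_two, Matrix.mul_apply, Fin.sum_univ_two] <;>
    norm_num

theorem sum_su2Coord (X : su2) : ∑ a, su2Coord a X • tau a = X := by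
  obtain ⟨X, h1, h2⟩ := X
  have h00 := congrFun (congrFun h1 0) 0
  have h01 := congrFun (congrFun h1 0) 1
  rw [Matrix.trace_fin_two] at h2
  simp only [Matrix.conjTranspose_apply, Matrix.neg_apply, Complex.ext_iff] at h00 h01 h2
  apply Subtype.ext
  ext i j
  fin_cases i <;> fin_cases j <;>
    simp [Fin.sum_univ_three, su2Coord, tau, pauli, Matrix.trace_fin_two, Matrix.mul_apply,
      Fin.sum_univ_two, Complex.ext_iff] at * <;> constructor <;> linarith

theorem su2Bracket_tau (b c : Fin 3) : su2Bracket (tau b) (tau c) = ∑ a, eps a b c • tau a := by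
  apply Subtype.ext
  ext i j
  fin_cases b <;> fin_cases c <;> fin_cases i <;> fin_cases j <;>
    simp [Fin.sum_univ_three, eps, tau, pauli, su2Bracket, Complex.ext_iff] <;> norm_num

/-! ### Exterior algebra of an oriented Euclidean 3-space -/

section LinearAlgebra

variable {V : Type*} [NormedAddCommGroup V] [InnerProductSpace ℝ V] [FiniteDimensional ℝ V]
  [Fact (finrank ℝ V = 3)]

/-- The Hodge star of a 1-form on an oriented Euclidean 3-space: `⋆α = α^♯ ⌟ Vol`, where
`α^♯ = ∑ α(u_i) u_i` for an orthonormal basis `u`. -/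
def hodgeStar (o : Orientation ℝ V (Fin 3)) (α : V →ₗ[ℝ] ℝ) : V [⋀^Fin 2]→ₗ[ℝ] ℝ :=
  o.volumeForm.curryLeft (∑ i, α (stdOrthonormalBasis ℝ V i) • stdOrthonormalBasis ℝ V i)

/-- The inner product induced on 2-forms,
`⟨σ, η⟩ = ∑_{i<j} σ(u_i, u_j) η(u_i, u_j)` for an orthonormal basis `u`. -/
def innerTwoForm (σ η : V [⋀^Fin 2]→ₗ[ℝ] ℝ) : ℝ :=
  (1 / 2) * ∑ i, ∑ j,
    σ ![stdOrthonormalBasis ℝ V i, stdOrthonormalBasis ℝ V j] *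
    η ![stdOrthonormalBasis ℝ V i, stdOrthonormalBasis ℝ V j]

end LinearAlgebra

/-- The wedge product `α ∧ β = α ⊗ β - β ⊗ α` of two 1-forms. -/
def wedge {V : Type*} [AddCommGroup V] [Module ℝ V] (α β : V →ₗ[ℝ] ℝ) :
    V [⋀^Fin 2]→ₗ[ℝ] ℝ :=
  (Matrix.detRowAlternating (n := Fin 2) (R := ℝ)).compLinearMap (LinearMap.pi ![α, β])

/-! ### Coordinates -/

section Charts

variable {M : Type*} [TopologicalSpace M] [ChartedSpace E3 M]

/-- The coordinate vector `∂_i` at `x` of the chart `φ`. -/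
def coordVec (φ : OpenPartialHomeomorph M E3) (i : Fin 3) (x : M) : TangentSpace I3 x :=
  (mvfderiv I3 φ x).inverse (EuclideanSpace.single i (1 : ℝ))

/-- The coordinate 1-form `dx^i` at `x` of the chart `φ`. -/
def coordForm (φ : OpenPartialHomeomorph M E3) (i : Fin 3) (x : M) :
    TangentSpace I3 x →L[ℝ] ℝ :=
  (EuclideanSpace.proj i : E3 →L[ℝ] ℝ) ∘L mvfderiv I3 φ x

/-- The partial derivative `∂f/∂x^i` at `x` in the chart `φ`. -/
def partialD (φ : OpenPartialHomeomorph M E3) (i : Fin 3) (f : M → ℝ) (x : M) : ℝ :=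
  fderiv ℝ (fun y => f (φ.symm y)) (φ x) (EuclideanSpace.single i (1 : ℝ))

/-- The coordinate volume form `dx¹ ∧ dx² ∧ dx³` at `x` of the chart `φ`. -/
def coordVol (φ : OpenPartialHomeomorph M E3) (x : M) :
    TangentSpace I3 x [⋀^Fin 3]→ₗ[ℝ] ℝ :=
  (Matrix.detRowAlternating (n := Fin 3) (R := ℝ)).compLinearMap
    (LinearMap.pi fun i => (coordForm φ i x).toLinearMap)

/-- The exterior derivative of a 1-form, `dα = ∑ ∂_i α_j dx^i ∧ dx^j`, computed at `x` in the
preferred chart at `x`. -/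
def extDer (α : (x : M) → TangentSpace I3 x →L[ℝ] ℝ) (x : M) :
    TangentSpace I3 x [⋀^Fin 2]→ₗ[ℝ] ℝ :=
  ∑ i, ∑ j, partialD (chartAt E3 x) i (fun y => α y (coordVec (chartAt E3 x) j y)) x •
    wedge (coordForm (chartAt E3 x) i x).toLinearMap (coordForm (chartAt E3 x) j x).toLinearMap

end Charts

/-! ### `su(2)`-valued 1-forms and their curvature -/

section Gauge

variable {M : Type*} [TopologicalSpace M] [ChartedSpace E3 M]

/-- The component `A^a` of an `su(2)`-valued 1-form `A = A^a τ_a`. -/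
def comp (A : (x : M) → TangentSpace I3 x →L[ℝ] su2) (a : Fin 3) (x : M) :
    TangentSpace I3 x →L[ℝ] ℝ :=
  su2Coord a ∘L A x

variable (M) in
/-- An Ashtekar connection in the gauge given by the dreibein: a smooth `su(2)`-valued 1-form
on the 3-manifold. -/
structure AshtekarConnection [IsManifold I3 ∞ M] where
  toFun : (x : M) → TangentSpace I3 x →L[ℝ] su2
  smooth : ∀ (a : Fin 3) (X : (x : M) → TangentSpace I3 x),
    ContMDiff I3 I3.tangent ∞ (fun x => (⟨x, X x⟩ : TangentBundle I3 M)) →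
    ContMDiff I3 𝓘(ℝ) ∞ (fun x => comp toFun a x (X x))

/-- The curvature `F = dA + ½ [A ∧ A]`, an `su(2)`-valued 2-form, where
`dA = dA^a ⊗ τ_a` and `[A ∧ A] = A^b ∧ A^c ⊗ [τ_b, τ_c]`. -/
def curvature (A : (x : M) → TangentSpace I3 x →L[ℝ] su2) (x : M) :
    TangentSpace I3 x [⋀^Fin 2]→ₗ[ℝ] su2 :=
  (∑ a, (LinearMap.toSpanSingleton ℝ su2 (tau a)).compAlternatingMap (extDer (comp A a) x)) +
  (1 / 2 : ℝ) • ∑ b, ∑ c,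
    (LinearMap.toSpanSingleton ℝ su2 (su2Bracket (tau b) (tau c))).compAlternatingMap
      (wedge (comp A b x).toLinearMap (comp A c x).toLinearMap)

/-- The scalar 2-forms `F^b` normalised by `F = ½ F^b ⊗ τ_b`, so that
`F^b = F^b_{ij} dx^i ∧ dx^j` (sum over all `i, j`) in coordinates. -/
def curvComp (A : (x : M) → TangentSpace I3 x →L[ℝ] su2) (b : Fin 3) (x : M) :
    TangentSpace I3 x [⋀^Fin 2]→ₗ[ℝ] ℝ :=
  (2 : ℝ) • (su2Coord b).toLinearMap.compAlternatingMap (curvature A x)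

/-- The field strength
`F^a_{ij} = ∂_i A^a_j - ∂_j A^a_i + ε^a_{bc} A^b_i A^c_j` in the chart `φ`. -/
def fieldStrength (A : (x : M) → TangentSpace I3 x →L[ℝ] su2)
    (φ : OpenPartialHomeomorph M E3) (a i j : Fin 3) (x : M) : ℝ :=
  partialD φ i (fun y => comp A a y (coordVec φ j y)) x -
  partialD φ j (fun y => comp A a y (coordVec φ i y)) x +
  ∑ b, ∑ c, eps a b c * comp A b x (coordVec φ i x) * comp A c x (coordVec φ j x)

end Gauge

/-! ### The Riemannian manifold with its dreibein -/

section Riemannian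

variable {M : Type*} [TopologicalSpace M] [ChartedSpace E3 M] [IsManifold I3 ∞ M]
  [RiemannianBundle (fun x : M => TangentSpace I3 x)]

instance factFinrankTangent (x : M) : Fact (finrank ℝ (TangentSpace I3 x) = 3) :=
  ⟨finrank_euclideanSpace_fin (𝕜 := ℝ) (n := 3)⟩

instance finiteDimensionalTangent (x : M) : FiniteDimensional ℝ (TangentSpace I3 x) :=
  inferInstanceAs (FiniteDimensional ℝ E3)

/-- A dreibein on the Riemannian 3-manifold `M` with orientation `o`: a smooth section of the
bundle of oriented orthonormal frames. -/
structure Dreibein (o : (x : M) → Orientation ℝ (TangentSpace I3 x) (Fin 3)) where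
  frame : (x : M) → OrthonormalBasis (Fin 3) ℝ (TangentSpace I3 x)
  oriented : ∀ x, (frame x).toBasis.orientation = o x
  smooth : ∀ a,
    ContMDiff I3 I3.tangent ∞ (fun x => (⟨x, frame x a⟩ : TangentBundle I3 M))

/-- The Riemannian volume form `Vol_q`. -/
def vol (o : (x : M) → Orientation ℝ (TangentSpace I3 x) (Fin 3)) (x : M) :
    TangentSpace I3 x [⋀^Fin 3]→ₗ[ℝ] ℝ :=
  (o x).volumeForm

variable {o : (x : M) → Orientation ℝ (TangentSpace I3 x) (Fin 3)}

/-- The dual coframe `e^a`; as the frame is orthonormal, `e^a = q(e_a, ·)`. -/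
def coframe (e : Dreibein o) (a : Fin 3) (x : M) : TangentSpace I3 x →L[ℝ] ℝ :=
  innerSL ℝ (e.frame x a)

/-- The diffeomorphism constraint
`𝒱 = ½ ε_{abc} ⟨F^b, ⋆e^c⟩ Vol_q ⊗ e^a`, a section of `Λ³T*M ⊗ T*M`. -/
def diffeoConstraint (e : Dreibein o) (A : (x : M) → TangentSpace I3 x →L[ℝ] su2) (x : M) :
    TangentSpace I3 x →ₗ[ℝ] (TangentSpace I3 x [⋀^Fin 3]→ₗ[ℝ] ℝ) :=
  ∑ a, ∑ b, ∑ c,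
    ((1 / 2) * eps a b c *
      innerTwoForm (curvComp A b x) (hodgeStar (o x) (coframe e c x).toLinearMap)) •
    (coframe e a x).toLinearMap.smulRight (vol o x)

/-! ### The metric in coordinates and the densitized dreibein -/

/-- The matrix `q_{ij}` of the metric in the chart `φ`. -/
def metricMatrix (φ : OpenPartialHomeomorph M E3) (x : M) : Matrix (Fin 3) (Fin 3) ℝ :=
  Matrix.of fun i j => ⟪coordVec φ i x, coordVec φ j x⟫_ℝ

/-- `√q = √(det q_{ij})` in the chart `φ`. -/
def sqrtQ (φ : OpenPartialHomeomorph M E3) (x : M) : ℝ :=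
  Real.sqrt (metricMatrix φ x).det

/-- The components `E^i_a = √q e^i_a` of the densitized dreibein in the chart `φ`. -/
def densDreibein (e : Dreibein o) (φ : OpenPartialHomeomorph M E3) (i a : Fin 3) (x : M) : ℝ :=
  sqrtQ φ x * coordForm φ i x (e.frame x a)

/-! ### Covariant derivatives -/

/-- The covariant derivative of a vector field `Y = Y^a e_a` induced by the connection `A`:
`D Y = (dY^c + ε_{ba}^c A^b Y^a) e_c`; in particular `D e_a = A^b ε_{ba}^c e_c`. -/
def inducedCovFun (e : Dreibein o) (A : (x : M) → TangentSpace I3 x →L[ℝ] su2)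
    (Y : (x : M) → TangentSpace I3 x) (x : M) : TangentSpace I3 x →L[ℝ] TangentSpace I3 x :=
  ∑ c, (mvfderiv I3 (fun y => ⟪e.frame y c, Y y⟫_ℝ) x +
    ∑ b, ∑ a, (eps b a c * ⟪e.frame x a, Y x⟫_ℝ) • comp A b x).smulRight (e.frame x c)

theorem Dreibein.mdifferentiableAt (e : Dreibein o) (a : Fin 3) (x : M) :
    MDifferentiableAt I3 I3.tangent (fun y => (⟨y, e.frame y a⟩ : TangentBundle I3 M)) x :=
  (e.smooth a).mdifferentiableAt (by simp)

variable [IsContMDiffRiemannianBundle I3 ∞ E3 (fun x : M => TangentSpace I3 x)]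

instance metricC1 : IsContMDiffRiemannianBundle I3 1 E3 (fun x : M => TangentSpace I3 x) :=
  IsContMDiffRiemannianBundle.of_le (n := ∞) (by simp)

/-- The covariant derivative `D` on `TM` induced by the connection `A`. -/
def inducedCov (e : Dreibein o) (A : (x : M) → TangentSpace I3 x →L[ℝ] su2) :
    CovariantDerivative I3 E3 (TangentSpace I3 : M → Type _) where
  toFun := inducedCovFun e A
  isCovariantDerivativeOnUniv :=
    { add := by
        intro Y Z x hY hZ _
        have h := fun c => mvfderiv_fun_add ((e.mdifferentiableAt c x).inner_bundle hY)
          ((e.mdifferentiableAt c x).inner_bundle hZ)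
        ext1 v
        simp only [inducedCovFun, Pi.add_apply, inner_add_right, h, _root_.sum_apply,
          ContinuousLinearMap.smulRight_apply, _root_.add_apply,
          _root_.smul_apply, ← Finset.sum_add_distrib, ← add_smul, smul_eq_mul]
        refine Finset.sum_congr rfl fun c _ => ?_
        congr 1
        simp only [mul_add, add_mul, Finset.sum_add_distrib]
        ring
      leibniz := by
        intro Y g x hY hg _
        have h := fun c => mvfderiv_fun_mul hg ((e.mdifferentiableAt c x).inner_bundle hY)
        ext1 v
        have hs := (e.frame x).sum_repr' (Y x)
        simp only [inducedCovFun, Pi.smul_apply', inner_smul_right, h,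
          _root_.sum_apply,
          ContinuousLinearMap.smulRight_apply, _root_.add_apply,
          _root_.smul_apply, smul_eq_mul]
        conv_rhs => rw [← hs]
        rw [Finset.smul_sum, Finset.smul_sum, ← Finset.sum_add_distrib]
        refine Finset.sum_congr rfl fun c _ => ?_
        rw [smul_smul, smul_smul, ← add_smul]
        congr 1
        have : ∀ b a, eps b a c * (g x * ⟪e.frame x a, Y x⟫_ℝ) * comp A b x v =
          g x * (eps b a c * ⟪e.frame x a, Y x⟫_ℝ * comp A b x v) := fun b a => by ring
        rw [hs]
        simp only [this, ← Finset.mul_sum]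
        ring }

/-! ### The Levi-Civita connection -/

/-- The coefficients `ω_{dab} = q(∇_{e_d} e_a, e_b)` of the Levi-Civita connection in the
orthonormal frame, given by the Koszul formula. -/
def koszul (e : Dreibein o) (d a b : Fin 3) (x : M) : ℝ :=
  (1 / 2) *
    (⟪VectorField.mlieBracket I3 (fun y => e.frame y d) (fun y => e.frame y a) x,
        e.frame x b⟫_ℝ -
      ⟪VectorField.mlieBracket I3 (fun y => e.frame y d) (fun y => e.frame y b) x,
        e.frame x a⟫_ℝ -
      ⟪VectorField.mlieBracket I3 (fun y => e.frame y a) (fun y => e.frame y b) x,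
        e.frame x d⟫_ℝ)

/-- The Levi-Civita connection form `Γ = Γ^c τ_c` in the dreibein, determined by
`∇ e_a = Γ^c ε_{ca}^b e_b`, that is `Γ^c = ½ ε_{cab} q(∇ e_a, e_b)`. -/
def spinConnection (e : Dreibein o) (x : M) : TangentSpace I3 x →L[ℝ] su2 :=
  ∑ c, ∑ d, ((1 / 2) * ∑ a, ∑ b, eps c a b * koszul e d a b x) •
    (coframe e d x).smulRight (tau c)

/-- The Levi-Civita covariant derivative `∇`. -/
def leviCivita (e : Dreibein o) : CovariantDerivative I3 E3 (TangentSpace I3 : M → Type _) :=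
  inducedCov e (spinConnection e)

theorem inducedCov_frame (e : Dreibein o) (A : (x : M) → TangentSpace I3 x →L[ℝ] su2)
    (a : Fin 3) (x : M) (v : TangentSpace I3 x) :
    inducedCov e A (fun y => e.frame y a) x v =
      ∑ c, (∑ b, eps b a c * comp A b x v) • e.frame x c := by
  have h : ∀ c, mvfderiv I3 (fun y : M => ⟪e.frame y c, e.frame y a⟫_ℝ) x = 0 := by
    intro c
    have : (fun y : M => ⟪e.frame y c, e.frame y a⟫_ℝ) =
        fun _ => if c = a then (1 : ℝ) else 0 := by
      funext y
      exact orthonormal_iff_ite.1 (e.frame y).orthonormal c a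
    rw [this]
    exact mvfderiv_const _
  change inducedCovFun e A (fun y => e.frame y a) x v = _
  simp only [inducedCovFun, h, zero_add, _root_.sum_apply, ContinuousLinearMap.smulRight_apply,
    _root_.smul_apply, smul_eq_mul, orthonormal_iff_ite.1 (e.frame x).orthonormal]
  simp

theorem inducedCov_isMetricCompatible (e : Dreibein o)
    (A : (x : M) → TangentSpace I3 x →L[ℝ] su2) : (inducedCov e A).IsMetricCompatible := by
  rw [CovariantDerivative.isMetricCompatible_iff]
  intro x X Y Z _ hY hZ
  have hY' := fun c => (e.mdifferentiableAt c x).inner_bundle hY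
  have hZ' := fun c => (e.mdifferentiableAt c x).inner_bundle hZ
  have h : (fun y : M => ⟪Y y, Z y⟫_ℝ) =
      fun y => ∑ c, ⟪e.frame y c, Y y⟫_ℝ * ⟪e.frame y c, Z y⟫_ℝ := by
    funext y
    rw [← (e.frame y).sum_inner_mul_inner]
    refine Finset.sum_congr rfl fun c _ => ?_
    rw [real_inner_comm]
  have hd : ∀ c, MDifferentiableAt I3 𝓘(ℝ)
      (fun y => ⟪e.frame y c, Y y⟫_ℝ * ⟪e.frame y c, Z y⟫_ℝ) x := fun c => (hY' c).mul (hZ' c)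
  rw [h]
  simp only [Fin.sum_univ_three]
  have h01 : MDifferentiableAt I3 𝓘(ℝ)
      (fun y => ⟪e.frame y 0, Y y⟫_ℝ * ⟪e.frame y 0, Z y⟫_ℝ +
        ⟪e.frame y 1, Y y⟫_ℝ * ⟪e.frame y 1, Z y⟫_ℝ) x := (hd 0).add (hd 1)
  rw [mvfderiv_fun_add h01 (hd 2), mvfderiv_fun_add (hd 0) (hd 1),
    mvfderiv_fun_mul (hY' 0) (hZ' 0), mvfderiv_fun_mul (hY' 1) (hZ' 1),
    mvfderiv_fun_mul (hY' 2) (hZ' 2)]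
  change _ = ⟪inducedCovFun e A Y x (X x), Z x⟫_ℝ + ⟪Y x, inducedCovFun e A Z x (X x)⟫_ℝ
  simp only [inducedCovFun, _root_.sum_apply, inner_sum, sum_inner,
    ContinuousLinearMap.smulRight_apply, inner_smul_right, real_inner_smul_left, _root_.add_apply, _root_.smul_apply, smul_eq_mul,
    real_inner_comm (e.frame x _) (Y x)]
  simp [Fin.sum_univ_three, eps]
  ring

/-- The Levi-Civita covariant derivative is metric. -/
theorem leviCivita_isMetricCompatible (e : Dreibein o) :
    (leviCivita e).IsMetricCompatible :=
  inducedCov_isMetricCompatible e _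

/-- The Levi-Civita covariant derivative is torsion-free. -/
theorem leviCivita_torsion (e : Dreibein o) : (leviCivita e).torsion = 0 := by
  have key : ∀ (x : M) (d a : Fin 3),
      (leviCivita e).torsion x (e.frame x d) (e.frame x a) = 0 := by
    intro x d a
    rw [(leviCivita e).torsion_apply (X := fun y => e.frame y d) (Y := fun y => e.frame y a)
      (e.mdifferentiableAt d x) (e.mdifferentiableAt a x)]
    have hskew : ∀ d a b : Fin 3, koszul e d b a x = - koszul e d a b x := by
      intro d a b
      simp only [koszul]
      rw [VectorField.mlieBracket_swap_apply (V := fun y => e.frame y b)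
        (W := fun y => e.frame y a), inner_neg_left]
      ring
    have hcomp : ∀ c d, comp (spinConnection e) c x (e.frame x d) =
        (1 / 2) * ∑ a, ∑ b, eps c a b * koszul e d a b x := by
      intro c d
      simp only [comp, spinConnection, coframe, ContinuousLinearMap.comp_apply,
        _root_.sum_apply, _root_.smul_apply, ContinuousLinearMap.smulRight_apply, map_sum, map_smul,
        su2Coord_tau, innerSL_apply_apply, orthonormal_iff_ite.1 (e.frame x).orthonormal]
      simp
    have hcov : ∀ d a b, ⟪leviCivita e (fun y => e.frame y a) x (e.frame x d),
        e.frame x b⟫_ℝ = koszul e d a b x := by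
      intro d a b
      rw [leviCivita, inducedCov_frame]
      simp only [hcomp, sum_inner, real_inner_smul_left,
        orthonormal_iff_ite.1 (e.frame x).orthonormal]
      have h01 := hskew d 0 1
      have h02 := hskew d 0 2
      have h12 := hskew d 1 2
      have h00 := hskew d 0 0
      have h11 := hskew d 1 1
      have h22 := hskew d 2 2
      fin_cases a <;> fin_cases b <;> simp [Fin.sum_univ_three, eps] <;> linarith
    refine InnerProductSpace.ext_inner_right_basis (e.frame x).toBasis fun b => ?_
    rw [OrthonormalBasis.coe_toBasis, inner_sub_left, inner_sub_left, hcov, hcov, inner_zero_left]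
    simp only [koszul]
    rw [VectorField.mlieBracket_swap_apply (V := fun y => e.frame y a)
        (W := fun y => e.frame y d), inner_neg_left]
    ring
  funext x
  refine ContinuousLinearMap.coe_injective ((e.frame x).toBasis.ext fun d => ?_)
  refine ContinuousLinearMap.coe_injective ((e.frame x).toBasis.ext fun a => ?_)
  simpa using key x d a

/-! ### The constraints and the reconstructed data -/

/-- The covariant divergence of the densitized dreibein `E_a = Vol_q ⊗ e_a`,
`div (E_a) = tr (Y ↦ D_Y e_a) Vol_q`. -/
def divDens (D : CovariantDerivative I3 E3 (TangentSpace I3 : M → Type _)) (e : Dreibein o)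
    (a : Fin 3) (x : M) : TangentSpace I3 x [⋀^Fin 3]→ₗ[ℝ] ℝ :=
  LinearMap.trace ℝ (TangentSpace I3 x) (D (fun y => e.frame y a) x).toLinearMap • vol o x

/-- The Gauss constraint `G_a = div_∇ (E_a) - div_D (E_a)`. -/
def gaussConstraint (e : Dreibein o) (A : (x : M) → TangentSpace I3 x →L[ℝ] su2)
    (a : Fin 3) (x : M) : TangentSpace I3 x [⋀^Fin 3]→ₗ[ℝ] ℝ :=
  divDens (leviCivita e) e a x - divDens (inducedCov e A) e a x

/-- The reconstructed Weingarten map `W = K^a ⊗ e_a`, where `A = Γ + β K`. -/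
def weingarten (e : Dreibein o) (A : (x : M) → TangentSpace I3 x →L[ℝ] su2) (β : ℝ) (x : M) :
    TangentSpace I3 x →L[ℝ] TangentSpace I3 x :=
  ∑ a, (β⁻¹ • (comp A a x - comp (spinConnection e) a x)).smulRight (e.frame x a)

/-- The Christoffel symbols `Γ^k_{ij} = dx^k (∇_{∂_i} ∂_j)` in the chart `φ`. -/
def christoffel (e : Dreibein o) (φ : OpenPartialHomeomorph M E3) (k i j : Fin 3) (x : M) : ℝ :=
  coordForm φ k x (leviCivita e (fun y => coordVec φ j y) x (coordVec φ i x))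

/-- The components `W_i^j` of an endomorphism field in the chart `φ`: `W(∂_i) = W_i^j ∂_j`. -/
def endComp (W : (x : M) → TangentSpace I3 x →L[ℝ] TangentSpace I3 x)
    (φ : OpenPartialHomeomorph M E3) (i j : Fin 3) (x : M) : ℝ :=
  coordForm φ j x (W x (coordVec φ i x))

/-- The left-hand side of the contracted Codazzi equation (in a Ricci-flat spacetime) for
`(q, W)`, namely `∇_i W_j^j - ∇_j W_i^j`, in the chart `φ`:
`∂_i W_j^j - ∂_j W_i^j + Γ^j_{il} W_j^l - Γ^j_{jl} W_i^l`. -/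
def contractedCodazzi (e : Dreibein o)
    (W : (x : M) → TangentSpace I3 x →L[ℝ] TangentSpace I3 x)
    (φ : OpenPartialHomeomorph M E3) (i : Fin 3) (x : M) : ℝ :=
  ∑ j, (partialD φ i (endComp W φ j j) x - partialD φ j (endComp W φ i j) x +
    ∑ l, (christoffel e φ j i l x * endComp W φ j l x -
      christoffel e φ j j l x * endComp W φ i l x))

/-- The extrinsic curvature `K_{ij} = q(W(∂_i), ∂_j)`, as a matrix. -/
def extrinsic (W : (x : M) → TangentSpace I3 x →L[ℝ] TangentSpace I3 x)
    (φ : OpenPartialHomeomorph M E3) (x : M) : Matrix (Fin 3) (Fin 3) ℝ :=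
  Matrix.of fun i j => ⟪W x (coordVec φ i x), coordVec φ j x⟫_ℝ

/-- The ADM momentum `P^{ij} = (√q / k) (K^{ij} - q^{ij} K^l_l)`, with indices raised by the
inverse metric. -/
def admMomentum (W : (x : M) → TangentSpace I3 x →L[ℝ] TangentSpace I3 x) (k : ℝ)
    (φ : OpenPartialHomeomorph M E3) (i j : Fin 3) (x : M) : ℝ :=
  sqrtQ φ x / k *
    (((metricMatrix φ x)⁻¹ * extrinsic W φ x * (metricMatrix φ x)⁻¹) i j -
      (metricMatrix φ x)⁻¹ i j * ((metricMatrix φ x)⁻¹ * extrinsic W φ x).trace)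

/-- The covariant divergence `D_k P^{kj}` of a tensor density of weight one,
`D_m P^{kj} = ∂_m P^{kj} + Γ^k_{ml} P^{lj} + Γ^j_{ml} P^{kl} - Γ^l_{lm} P^{kj}`. -/
def divDensity (e : Dreibein o) (φ : OpenPartialHomeomorph M E3)
    (P : Fin 3 → Fin 3 → M → ℝ) (j : Fin 3) (x : M) : ℝ :=
  ∑ k, (partialD φ k (P k j) x + ∑ l, (christoffel e φ k k l x * P l j x +
    christoffel e φ j k l x * P k l x - christoffel e φ l l k x * P k j x))

/-- The ADM supermomentum `H_i = -2 q_{ij} D_k P^{kj}` in the chart `φ`. -/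
def supermomentum (e : Dreibein o)
    (W : (x : M) → TangentSpace I3 x →L[ℝ] TangentSpace I3 x) (k : ℝ)
    (φ : OpenPartialHomeomorph M E3) (i : Fin 3) (x : M) : ℝ :=
  -2 * ∑ j, metricMatrix φ x i j * divDensity e φ (admMomentum W k φ) j x

end Riemannian

end Ashtekar

end

open scoped Manifold ContDiff Bundle InnerProductSpace
open Module Bundle
open scoped Topology
open Filter

noncomputable section

namespace Ashtekar

/-! ### Coordinate fields and partial derivatives of an arbitrary chart. -/

section ChartCalculus

variable {M : Type*} [TopologicalSpace M] [ChartedSpace E3 M]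
  {φ : OpenPartialHomeomorph M E3} {x : M}

/-! In an oriented orthonormal frame, `⋆e^c` has components `ε_{cmn}`, so contracting two epsilons
gives `𝒱(X) = ½ ∑_b F^b(X, e_b) Vol` (`diffeoConstraint_apply`). Since `F^b(∂_i, ∂_j) = 2 F^b_{ij}`
and `Vol = √q dx¹∧dx²∧dx³`, this is the coordinate formula. It also reduces `𝒱 = 0` at a point to
the vanishing of the three numbers `e_b^j F^b_{ij}`, computed in any chart as functions on `ℝ³`.

If `D` is torsion-free, differentiating the torsion gives the algebraic Bianchi identity `ε_{bac}
F^b ∧ e^a = 0`. Contracted with `e^c_i`, the products of two coframe components become cofactors of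
the coframe matrix, that is, `det e` times the frame; hence `e_b^j F^b_{ij} = 0`
(`contracted_frameCurvature_eq_zero`).

In general `F_A = F_Γ + β d_Γ K + ½ β² [K ∧ K]`, up to the normalisation of components. The first
term drops out of the contraction because `Γ` is torsion-free. The Gauss constraint is the vanishing
of the antisymmetric part of `K^a(e_b)`, which kills the quadratic term. The tetrad postulate turns
the linear term into `β (∇_i W_j^j - ∇_j W_i^j)` (`contracted_frameCurvature_add`), so `𝒱 = 0` is
the contracted Codazzi equation.

Finally `√q` and `q^{ij}` are parallel, so the divergence passes through them and `H_i = (2√q/k)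
(∇_i W_j^j - ∇_j W_i^j)`, a nonzero multiple of the same expression (`divergence_momentum`,
`supermomentum_eq`). -/

theorem contMDiffAt_chart (hφ : φ ∈ IsManifold.maximalAtlas I3 ∞ M) (hx : x ∈ φ.source) :
    ContMDiffAt I3 I3 ∞ φ x :=
  contMDiffAt_of_mem_maximalAtlas hφ hx

theorem contMDiffAt_chart_symm (hφ : φ ∈ IsManifold.maximalAtlas I3 ∞ M) {u : E3}
    (hu : u ∈ φ.target) : ContMDiffAt I3 I3 ∞ φ.symm u :=
  contMDiffAt_symm_of_mem_maximalAtlas hφ hu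

theorem mdifferentiable_of_mem_maximalAtlas (hφ : φ ∈ IsManifold.maximalAtlas I3 ∞ M) :
    φ.MDifferentiable I3 I3 :=
  ⟨fun _ hx => ((contMDiffAt_chart hφ hx).mdifferentiableAt (by simp)).mdifferentiableWithinAt,
    fun _ hu =>
      ((contMDiffAt_chart_symm hφ hu).mdifferentiableAt (by simp)).mdifferentiableWithinAt⟩

theorem isInvertible_mfderiv_chart (hφ : φ ∈ IsManifold.maximalAtlas I3 ∞ M)
    (hx : x ∈ φ.source) : (mfderiv I3 I3 φ x).IsInvertible :=
  ⟨(mdifferentiable_of_mem_maximalAtlas hφ).mfderiv hx, rfl⟩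

theorem mvfderiv_coordVec (hφ : φ ∈ IsManifold.maximalAtlas I3 ∞ M) (hx : x ∈ φ.source)
    (i : Fin 3) : mvfderiv I3 φ x (coordVec φ i x) = EuclideanSpace.single i (1 : ℝ) := by
  obtain ⟨L, hL⟩ := isInvertible_mfderiv_chart hφ hx
  change mfderiv I3 I3 φ x ((mfderiv I3 I3 φ x).inverse (EuclideanSpace.single i (1 : ℝ))) = _
  rw [← hL, ContinuousLinearMap.inverse_equiv]
  exact L.apply_symm_apply _

theorem coordForm_coordVec (hφ : φ ∈ IsManifold.maximalAtlas I3 ∞ M) (hx : x ∈ φ.source)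
    (i j : Fin 3) : coordForm φ i x (coordVec φ j x) = if i = j then 1 else 0 := by
  simp [coordForm, mvfderiv_coordVec hφ hx]

theorem sum_coordForm_smul_coordVec (hφ : φ ∈ IsManifold.maximalAtlas I3 ∞ M)
    (hx : x ∈ φ.source) (v : TangentSpace I3 x) :
    ∑ j, coordForm φ j x v • coordVec φ j x = v := by
  have hinj : Function.Injective (mvfderiv I3 φ x) :=
    (mdifferentiable_of_mem_maximalAtlas hφ).mfderiv_injective hx
  apply hinj
  rw [map_sum]
  simp only [map_smul, mvfderiv_coordVec hφ hx]
  ext i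
  simp [coordForm, Finset.sum_apply, Pi.single_apply]

/-- Chain rule for `f ∘ φ.symm`: the differential of `φ.symm` carries the `i`-th basis vector to the
coordinate vector. -/
theorem mvfderiv_apply_coordVec (hφ : φ ∈ IsManifold.maximalAtlas I3 ∞ M) (hx : x ∈ φ.source)
    {f : M → ℝ} (hf : MDifferentiableAt I3 𝓘(ℝ) f x) (i : Fin 3) :
    mvfderiv I3 f x (coordVec φ i x) = partialD φ i f x := by
  have hs : MDifferentiableAt I3 I3 φ.symm (φ x) :=
    (contMDiffAt_chart_symm hφ (φ.map_source hx)).mdifferentiableAt (by simp)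
  have h1 : mfderiv I3 I3 φ.symm (φ x) (EuclideanSpace.single i (1 : ℝ)) = coordVec φ i x := by
    have h := (mdifferentiable_of_mem_maximalAtlas hφ).symm_comp_deriv hx
    have h2 := congrArg (fun T => T (coordVec φ i x)) h
    rw [← mvfderiv_coordVec hφ hx]
    exact h2
  have hf' : MDifferentiableAt I3 𝓘(ℝ) f (φ.symm (φ x)) := by rwa [φ.left_inv hx]
  have h3 : mfderiv I3 𝓘(ℝ) (f ∘ φ.symm) (φ x) = _ := mfderiv_comp (φ x) hf' hs
  have h4 : partialD φ i f x = mfderiv I3 𝓘(ℝ) (f ∘ φ.symm) (φ x) (EuclideanSpace.single i (1 : ℝ)) := by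
    rw [mfderiv_eq_fderiv]; rfl
  rw [h4, h3]
  refine Eq.trans ?_ (congrArg (mfderiv I3 𝓘(ℝ) f (φ.symm (φ x))) h1).symm
  rw [φ.left_inv hx]
  rfl

theorem contDiffAt_comp_chart_symm (hφ : φ ∈ IsManifold.maximalAtlas I3 ∞ M) (hx : x ∈ φ.source)
    {f : M → ℝ} (hf : ContMDiffAt I3 𝓘(ℝ) ∞ f x) :
    ContDiffAt ℝ ∞ (fun u => f (φ.symm u)) (φ x) := by
  have hf' : ContMDiffAt I3 𝓘(ℝ) ∞ f (φ.symm (φ x)) := by rwa [φ.left_inv hx]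
  exact (ContMDiffAt.comp (φ x) hf' (contMDiffAt_chart_symm hφ (φ.map_source hx))).contDiffAt

variable [IsManifold I3 ∞ M]

/-- The coordinate field is the pullback under the chart of a constant field on `ℝ³`. -/
theorem contMDiffAt_coordVec (hφ : φ ∈ IsManifold.maximalAtlas I3 ∞ M) (hx : x ∈ φ.source)
    (i : Fin 3) :
    ContMDiffAt I3 I3.tangent ∞ (fun y => (⟨y, coordVec φ i y⟩ : TangentBundle I3 M)) x := by
  have h : ContMDiffAt I3 I3.tangent ∞ (fun u : E3 =>
      (⟨u, (EuclideanSpace.single i (1 : ℝ) : E3)⟩ : TangentBundle I3 E3)) (φ x) :=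
    contMDiffAt_vectorSpace_iff_contDiffAt.2 contDiffAt_const
  exact ContMDiffAt.mpullback_vectorField_preimage (n := ∞) h (contMDiffAt_chart hφ hx)
    (isInvertible_mfderiv_chart hφ hx) (by simp)

/-- Lie brackets commute with pullback along the chart, and constant fields on `ℝ³` commute. -/
theorem mlieBracket_coordVec (hφ : φ ∈ IsManifold.maximalAtlas I3 ∞ M) (hx : x ∈ φ.source)
    (i j : Fin 3) :
    VectorField.mlieBracket I3 (fun y => coordVec φ i y) (fun y => coordVec φ j y) x = 0 := by
  let V : Fin 3 → (u : E3) → TangentSpace I3 u := fun i _ =>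
    (EuclideanSpace.single i (1 : ℝ) : E3)
  have h : ∀ i, MDifferentiableAt I3 I3.tangent (fun u => (⟨u, V i u⟩ : TangentBundle I3 E3))
      (φ x) := fun i =>
    (contMDiffAt_vectorSpace_iff_contDiffAt (n := 1).2 contDiffAt_const).mdifferentiableAt (by simp)
  have h2 : minSmoothness ℝ 2 ≤ (∞ : WithTop ℕ∞) := by
    rw [minSmoothness_of_isRCLikeNormedField]
    exact WithTop.coe_le_coe.2 le_top
  have := IsManifold.of_le (I := I3) (M := M) h2
  refine (VectorField.mpullback_mlieBracket (h i) (h j) (contMDiffAt_chart hφ hx) h2).symm.trans ?_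
  have h3 : VectorField.mlieBracket I3 (V i) (V j) (φ x) = 0 := by
    rw [← VectorField.mlieBracketWithin_univ, VectorField.mlieBracketWithin_eq_lieBracketWithin]
    simp only [VectorField.lieBracketWithin, V]
    simp
    rfl
  rw [VectorField.mpullback_apply]
  exact (congrArg _ h3).trans (map_zero _)

end ChartCalculus

/-! ### Partial derivatives on `ℝ³`. -/

section PartialDerivatives

/-- The `i`-th partial derivative of a function on `ℝ³`. -/
def pd (i : Fin 3) (f : E3 → ℝ) (u : E3) : ℝ :=
  fderiv ℝ f u (EuclideanSpace.single i (1 : ℝ))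

variable {f g : E3 → ℝ} {u : E3}

theorem pd_congr (h : f =ᶠ[𝓝 u] g) (i : Fin 3) : pd i f u = pd i g u := by
  rw [pd, pd, h.fderiv_eq]

theorem pd_add (hf : DifferentiableAt ℝ f u) (hg : DifferentiableAt ℝ g u) (i : Fin 3) :
    pd i (fun y => f y + g y) u = pd i f u + pd i g u := by
  simp [pd, fderiv_fun_add hf hg]

theorem pd_sub (hf : DifferentiableAt ℝ f u) (hg : DifferentiableAt ℝ g u) (i : Fin 3) :
    pd i (fun y => f y - g y) u = pd i f u - pd i g u := by
  simp [pd, fderiv_fun_sub hf hg]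

theorem pd_mul (hf : DifferentiableAt ℝ f u) (hg : DifferentiableAt ℝ g u) (i : Fin 3) :
    pd i (fun y => f y * g y) u = pd i f u * g u + f u * pd i g u := by
  simp [pd, fderiv_fun_mul hf hg]
  ring

theorem pd_const_mul (hf : DifferentiableAt ℝ f u) (c : ℝ) (i : Fin 3) :
    pd i (fun y => c * f y) u = c * pd i f u := by
  simp [pd, fderiv_const_mul hf]

theorem pd_const (c : ℝ) (i : Fin 3) : pd i (fun _ => c) u = 0 := by
  simp [pd]

theorem pd_sum {ι : Type*} {s : Finset ι} {F : ι → E3 → ℝ}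
    (hF : ∀ a ∈ s, DifferentiableAt ℝ (F a) u) (i : Fin 3) :
    pd i (fun y => ∑ a ∈ s, F a y) u = ∑ a ∈ s, pd i (F a) u := by
  simp [pd, fderiv_fun_sum hF]

theorem differentiableAt_pd (hf : ContDiffAt ℝ 2 f u) (i : Fin 3) :
    DifferentiableAt ℝ (pd i f) u :=
  ((hf.fderiv_right (m := 1) (by norm_num)).differentiableAt (by norm_num)).clm_apply
    (differentiableAt_const _)

theorem pd_comm (hf : ContDiffAt ℝ 2 f u) (i j : Fin 3) :
    pd i (pd j f) u = pd j (pd i f) u := by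
  have h : ∀ i j : Fin 3, pd i (pd j f) u = fderiv ℝ (fderiv ℝ f) u
      (EuclideanSpace.single i (1 : ℝ)) (EuclideanSpace.single j (1 : ℝ)) := by
    intro i j
    have hd : DifferentiableAt ℝ (fderiv ℝ f) u :=
      (hf.fderiv_right (m := 1) (by norm_num)).differentiableAt (by norm_num)
    unfold pd
    rw [fderiv_clm_apply hd (differentiableAt_const _)]
    simp
  rw [h, h]
  exact hf.isSymmSndFDerivAt (by simp) _ _

end PartialDerivatives

/-! ### Torsion, curvature and the algebraic Bianchi identity in components. -/

section FrameCalculus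

theorem fin_three_cases (i : Fin 3) : i = 0 ∨ i = 1 ∨ i = 2 := by
  fin_cases i <;> simp

/-- The curvature `∂_i A^a_j - ∂_j A^a_i + ε^a_{bc} A^b_i A^c_j` of functions `A^a_i` on `ℝ³`. -/
def frameCurvature (A : Fin 3 → Fin 3 → E3 → ℝ) (a i j : Fin 3) (u : E3) : ℝ :=
  pd i (A a j) u - pd j (A a i) u + ∑ b, ∑ c, eps a b c * A b i u * A c j u

/-- The torsion `∂_i e^c_j - ∂_j e^c_i + ε_{ba}^c (A^b_i e^a_j - A^b_j e^a_i)` of a coframe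
`e^c_i` with respect to functions `A^a_i` on `ℝ³`. -/
def frameTorsion (e A : Fin 3 → Fin 3 → E3 → ℝ) (c i j : Fin 3) (u : E3) : ℝ :=
  pd i (e c j) u - pd j (e c i) u +
    ∑ b, ∑ a, eps b a c * (A b i u * e a j u - A b j u * e a i u)

variable {e h A Γ K : Fin 3 → Fin 3 → E3 → ℝ} {u : E3}

theorem pd_frameTorsion (he : ∀ a i, ContDiffAt ℝ 2 (e a i) u)
    (hA : ∀ a i, DifferentiableAt ℝ (A a i) u) (k c i j : Fin 3) :
    pd k (frameTorsion e A c i j) u = pd k (pd i (e c j)) u - pd k (pd j (e c i)) u +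
      ∑ b, ∑ a, eps b a c * (pd k (A b i) u * e a j u + A b i u * pd k (e a j) u -
        (pd k (A b j) u * e a i u + A b j u * pd k (e a i) u)) := by
  have he' : ∀ a i, DifferentiableAt ℝ (e a i) u := fun a i =>
    (he a i).differentiableAt (by norm_num)
  have hd : ∀ b a i j, DifferentiableAt ℝ (fun y => A b i y * e a j y) u := fun b a i j =>
    (hA b i).mul (he' a j)
  unfold frameTorsion
  rw [pd_add (f := fun y => pd i (e c j) y - pd j (e c i) y)
    ((differentiableAt_pd (he c j) i).fun_sub (differentiableAt_pd (he c i) j))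
    (DifferentiableAt.fun_sum fun b _ => DifferentiableAt.fun_sum fun a _ =>
      ((hd b a i j).fun_sub (hd b a j i)).const_mul _),
    pd_sub (differentiableAt_pd (he c j) i) (differentiableAt_pd (he c i) j),
    pd_sum fun b _ => DifferentiableAt.fun_sum fun a _ =>
      ((hd b a i j).fun_sub (hd b a j i)).const_mul _]
  congr 1
  refine Finset.sum_congr rfl fun b _ => ?_
  rw [pd_sum fun a _ => ((hd b a i j).fun_sub (hd b a j i)).const_mul _]
  refine Finset.sum_congr rfl fun a _ => ?_
  rw [pd_const_mul ((hd b a i j).fun_sub (hd b a j i)), pd_sub (hd b a i j) (hd b a j i),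
    pd_mul (hA b i) (he' a j), pd_mul (hA b j) (he' a i)]

/-- The algebraic Bianchi identity `F^b ∧ e^a ε_{bac} = 0` of a torsion-free connection. -/
theorem cyclic_frameCurvature (he : ∀ a i, ContDiffAt ℝ 2 (e a i) u)
    (hA : ∀ a i, DifferentiableAt ℝ (A a i) u)
    (hT : ∀ᶠ y in 𝓝 u, ∀ c i j, frameTorsion e A c i j y = 0) (c : Fin 3) :
    ∑ b, ∑ a, eps b a c * (frameCurvature A b 0 1 u * e a 2 u +
      frameCurvature A b 1 2 u * e a 0 u + frameCurvature A b 2 0 u * e a 1 u) = 0 := by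
  -- The torsion vanishes on a neighbourhood, so its first derivatives vanish at `u` as well.
  have hdT : ∀ k c i j, pd k (frameTorsion e A c i j) u = 0 := by
    intro k c i j
    rw [pd_congr (g := fun _ => 0) (hT.mono fun y hy => hy c i j), pd_const]
  have hT0 := hT.self_of_nhds
  have h0 := hdT 2 c 0 1
  have h1 := hdT 0 c 1 2
  have h2 := hdT 1 c 2 0
  rw [pd_frameTorsion he hA] at h0 h1 h2
  rw [pd_comm (he c 1) 2 0] at h0
  rw [pd_comm (he c 2) 0 1] at h1
  rw [pd_comm (he c 0) 1 2] at h2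
  -- The form `A ∧ T`. Added to `dT`, it trades the terms `A ∧ de` for `A ∧ A ∧ e`, completing `dA`
  -- to the curvature; the second derivatives of `e` have cancelled by symmetry.
  have hS : ∑ b, ∑ a, eps b a c * (A b 0 u * frameTorsion e A a 1 2 u +
      A b 1 u * frameTorsion e A a 2 0 u + A b 2 u * frameTorsion e A a 0 1 u) = 0 := by
    simp [hT0]
  unfold frameTorsion at hS
  unfold frameCurvature
  fin_cases c <;> norm_num [Fin.sum_univ_three, eps] at h0 h1 h2 hS ⊢ <;>
    linear_combination h0 + h1 + h2 + hS

/-- The frame is the inverse matrix of the coframe, so `det e` times it is a matrix of cofactors,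
each quadratic in the coframe. -/
theorem adjugate_coframe (hhe : ∀ i j, ∑ b, h b i u * e b j u = if i = j then 1 else 0) :
    (Matrix.of fun b i => e b i u).adjugate =
      (Matrix.of fun b i => e b i u).det • (Matrix.of fun i b => h b i u) := by
  have h1 : (Matrix.of fun i b => h b i u) * (Matrix.of fun b i => e b i u) = 1 := by
    ext i j
    simpa [Matrix.mul_apply, Matrix.one_apply] using hhe i j
  calc (Matrix.of fun b i => e b i u).adjugate
      = ((Matrix.of fun i b => h b i u) * (Matrix.of fun b i => e b i u)) *
        (Matrix.of fun b i => e b i u).adjugate := by rw [h1, one_mul]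
    _ = _ := by rw [mul_assoc, Matrix.mul_adjugate, Matrix.mul_smul, mul_one]

theorem det_coframe_ne_zero (hhe : ∀ i j, ∑ b, h b i u * e b j u = if i = j then 1 else 0) :
    (Matrix.of fun b i => e b i u).det ≠ 0 := by
  have h1 : (Matrix.of fun i b => h b i u) * (Matrix.of fun b i => e b i u) = 1 := by
    ext i j
    simpa [Matrix.mul_apply, Matrix.one_apply] using hhe i j
  exact right_ne_zero_of_mul (a := (Matrix.of fun i b => h b i u).det)
    (by rw [← Matrix.det_mul, h1, Matrix.det_one]; exact one_ne_zero)

theorem frameCurvature_swap (A : Fin 3 → Fin 3 → E3 → ℝ) (a i j : Fin 3) (u : E3) :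
    frameCurvature A a i j u = -frameCurvature A a j i u := by
  unfold frameCurvature
  fin_cases a <;> norm_num [Fin.sum_univ_three, eps] <;> ring

/-- A torsion-free connection satisfies `∑_b F^b(∂_i, e_b) = 0`. -/
theorem contracted_frameCurvature_eq_zero (he : ∀ a i, ContDiffAt ℝ 2 (e a i) u)
    (hA : ∀ a i, DifferentiableAt ℝ (A a i) u)
    (hT : ∀ᶠ y in 𝓝 u, ∀ c i j, frameTorsion e A c i j y = 0)
    (hhe : ∀ i j, ∑ b, h b i u * e b j u = if i = j then 1 else 0) (i : Fin 3) :
    ∑ b, ∑ j, h b j u * frameCurvature A b i j u = 0 := by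
  have hB := cyclic_frameCurvature he hA hT
  have hadj := adjugate_coframe hhe
  -- Multiplying by `det e ≠ 0` makes the claim polynomial in the coframe, where it can be compared
  -- with the Bianchi identity.
  refine (mul_eq_zero.1 ?_).resolve_left (det_coframe_ne_zero hhe)
  have hc : ∀ b j, (Matrix.of fun b i => e b i u).det * h b j u =
      (Matrix.of fun b i => e b i u).adjugate j b := by
    intro b j
    rw [hadj]
    rfl
  -- The Bianchi identity contracted with `e^c_i`: the factors `ε_{bac} e^a_k e^c_i` are, up to
  -- sign, cofactors of the coframe matrix, and vanish for `k = i`.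
  have hs : (∑ c, e c i u * ∑ b, ∑ a, eps b a c * (frameCurvature A b 0 1 u * e a 2 u +
      frameCurvature A b 1 2 u * e a 0 u + frameCurvature A b 2 0 u * e a 1 u)) = 0 := by
    simp [hB]
  have hF := fun b => frameCurvature_swap A b
  have hd : ∀ b i, frameCurvature A b i i u = 0 := fun b i => by linarith [hF b i i u]
  simp only [Finset.mul_sum, ← mul_assoc, hc]
  rw [Matrix.adjugate_fin_three]
  rw [← hs]
  obtain rfl | rfl | rfl := fin_three_cases i <;>
    simp [Fin.sum_univ_three, eps, hd, hF _ 1 0, hF _ 2 1, hF _ 0 2] <;> ring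

end FrameCalculus

/-! ### The tetrad postulate, parallel tensors and the divergence of the momentum. -/

section CoordinateTensors

variable {e h Γ K W : Fin 3 → Fin 3 → E3 → ℝ} {C : Fin 3 → Fin 3 → Fin 3 → ℝ} {u : E3}

/-- The contracted Codazzi expression `∂_i W_j^j - ∂_j W_i^j + C^j_{il} W_j^l - C^j_{jl} W_i^l`
of functions `W_i^j` on `ℝ³`. -/
def frameCodazzi (C : Fin 3 → Fin 3 → Fin 3 → ℝ) (W : Fin 3 → Fin 3 → E3 → ℝ) (i : Fin 3)
    (u : E3) : ℝ :=
  ∑ j, (pd i (W j j) u - pd j (W i j) u + ∑ l, (C j i l * W j l u - C j j l * W i l u))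

/-- The components of `∇_i W` in a mixed basis and in coordinates. -/
theorem sum_coframe_covariant_derivative (he : ∀ a i, DifferentiableAt ℝ (e a i) u)
    (hW : ∀ i j, DifferentiableAt ℝ (W i j) u)
    (hhe : ∀ i j, ∑ b, h b i u * e b j u = if i = j then 1 else 0)
    (hKW : ∀ᶠ y in 𝓝 u, ∀ b j, K b j y = ∑ l, W j l y * e b l y)
    (hC : ∀ c i j, ∑ k, e c k u * C k i j =
      pd i (e c j) u + ∑ b, ∑ a, eps b a c * (Γ b i u * e a j u)) (i j m : Fin 3) :
    ∑ b, h b m u * (pd i (K b j) u + ∑ d, ∑ a, eps d a b * (Γ d i u * K a j u)) =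
      pd i (W j m) u + ∑ l, C m i l * W j l u := by
  have h1 : ∀ b, pd i (K b j) u =
      ∑ l, (pd i (W j l) u * e b l u + W j l u * pd i (e b l) u) := by
    intro b
    rw [pd_congr (hKW.mono fun y hy => hy b j), pd_sum fun l _ => (hW j l).fun_mul (he b l)]
    exact Finset.sum_congr rfl fun l _ => pd_mul (hW j l) (he b l) i
  -- The tetrad postulate `hC` absorbs the derivative of the coframe and the spin connection into
  -- the symbols `C`.
  have h2 : ∀ b, pd i (K b j) u + ∑ d, ∑ a, eps d a b * (Γ d i u * K a j u) =
      ∑ l, (pd i (W j l) u * e b l u + W j l u * ∑ k, e b k u * C k i l) := by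
    intro b
    rw [h1]
    simp only [hC, hKW.self_of_nhds _ _, Fin.sum_univ_three]
    ring
  simp only [h2]
  have e0 := hhe m 0
  have e1 := hhe m 1
  have e2 := hhe m 2
  obtain rfl | rfl | rfl := fin_three_cases m <;> simp [Fin.sum_univ_three] at e0 e1 e2 ⊢ <;>
    linear_combination
      (pd i (W j 0) u + C 0 i 0 * W j 0 u + C 0 i 1 * W j 1 u + C 0 i 2 * W j 2 u) * e0 +
      (pd i (W j 1) u + C 1 i 0 * W j 0 u + C 1 i 1 * W j 1 u + C 1 i 2 * W j 2 u) * e1 +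
      (pd i (W j 2) u + C 2 i 0 * W j 0 u + C 2 i 1 * W j 1 u + C 2 i 2 * W j 2 u) * e2

/-- `∑_b (d_Γ K)^b(∂_i, e_b)` is the contracted Codazzi expression. -/
theorem contracted_covariant_exterior_derivative (he : ∀ a i, DifferentiableAt ℝ (e a i) u)
    (hW : ∀ i j, DifferentiableAt ℝ (W i j) u)
    (hhe : ∀ i j, ∑ b, h b i u * e b j u = if i = j then 1 else 0)
    (hKW : ∀ᶠ y in 𝓝 u, ∀ b j, K b j y = ∑ l, W j l y * e b l y)
    (hC : ∀ c i j, ∑ k, e c k u * C k i j =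
      pd i (e c j) u + ∑ b, ∑ a, eps b a c * (Γ b i u * e a j u)) (i : Fin 3) :
    ∑ b, ∑ j, h b j u * (pd i (K b j) u - pd j (K b i) u +
      ∑ c, ∑ d, eps b c d * (Γ c i u * K d j u - Γ c j u * K d i u)) = frameCodazzi C W i u := by
  have h1 := fun i j m => sum_coframe_covariant_derivative he hW hhe hKW hC i j m
  have h2 : ∀ j, ∑ b, h b j u * (pd i (K b j) u - pd j (K b i) u +
      ∑ c, ∑ d, eps b c d * (Γ c i u * K d j u - Γ c j u * K d i u)) =
      pd i (W j j) u - pd j (W i j) u + ∑ l, (C j i l * W j l u - C j j l * W i l u) := by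
    intro j
    -- The exterior covariant derivative is the antisymmetrisation of `∂_i K^b_j + ε_{da}^b Γ^d_i
    -- K^a_j`, whose contraction with the frame is already known. Only the vector index of `W`
    -- carries `C`.
    have h3 : ∀ b, h b j u * (pd i (K b j) u - pd j (K b i) u +
        ∑ c, ∑ d, eps b c d * (Γ c i u * K d j u - Γ c j u * K d i u)) =
        h b j u * (pd i (K b j) u + ∑ d, ∑ a, eps d a b * (Γ d i u * K a j u)) -
        h b j u * (pd j (K b i) u + ∑ d, ∑ a, eps d a b * (Γ d j u * K a i u)) := by
      intro b
      have h4 : ∀ c d, eps b c d = eps c d b := fun c d => by unfold eps; ring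
      simp only [h4, mul_sub, Finset.sum_sub_distrib]
      ring
    simp only [h3, Finset.sum_sub_distrib, h1]
    ring
  rw [Finset.sum_comm, frameCodazzi]
  exact Finset.sum_congr rfl fun j _ => h2 j

/-- The curvature of `Γ + β K`, contracted with the frame, when `Γ` is torsion-free and `K` is
symmetric. -/
theorem contracted_frameCurvature_add {A : Fin 3 → Fin 3 → E3 → ℝ} {β : ℝ}
    (he : ∀ a i, ContDiffAt ℝ 2 (e a i) u)
    (hΓ : ∀ a i, DifferentiableAt ℝ (Γ a i) u) (hK : ∀ a i, DifferentiableAt ℝ (K a i) u)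
    (hW : ∀ i j, DifferentiableAt ℝ (W i j) u)
    (hhe : ∀ i j, ∑ b, h b i u * e b j u = if i = j then 1 else 0)
    (hT : ∀ᶠ y in 𝓝 u, ∀ c i j, frameTorsion e Γ c i j y = 0)
    (hKW : ∀ᶠ y in 𝓝 u, ∀ b j, K b j y = ∑ l, W j l y * e b l y)
    (hC : ∀ c i j, ∑ k, e c k u * C k i j =
      pd i (e c j) u + ∑ b, ∑ a, eps b a c * (Γ b i u * e a j u))
    (hA : ∀ a i y, A a i y = Γ a i y + β * K a i y)
    (hsym : ∀ a b, ∑ j, h b j u * K a j u = ∑ j, h a j u * K b j u) (i : Fin 3) :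
    ∑ b, ∑ j, h b j u * frameCurvature A b i j u = β * frameCodazzi C W i u := by
  have he' : ∀ a i, DifferentiableAt ℝ (e a i) u := fun a i =>
    (he a i).differentiableAt (by norm_num)
  have hA' : A = fun a i y => Γ a i y + β * K a i y := by
    funext a i y
    exact hA a i y
  have hpd : ∀ a i k, pd k (A a i) u = pd k (Γ a i) u + β * pd k (K a i) u := by
    intro a i k
    rw [hA', pd_add (hΓ a i) ((hK a i).const_mul β), pd_const_mul (hK a i)]
  have h1 := contracted_frameCurvature_eq_zero he hΓ hT hhe i
  have h2 := contracted_covariant_exterior_derivative he' hW hhe hKW hC i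
  -- The quadratic term pairs the antisymmetric `ε_{bcd}` with `K^d(e_b)`, which `hsym` makes
  -- symmetric in `b` and `d`.
  have h3 : ∑ b, ∑ c, ∑ d, eps b c d * (K c i u * ∑ j, h b j u * K d j u) = 0 := by
    have s01 := hsym 0 1
    have s02 := hsym 0 2
    have s12 := hsym 1 2
    simp only [Fin.sum_univ_three (fun j => _ * _)] at s01 s02 s12 ⊢
    norm_num [Fin.sum_univ_three, eps]
    linear_combination K 2 i u * s01 - K 1 i u * s02 + K 0 i u * s12
  have h4 : ∀ b j, h b j u * frameCurvature A b i j u = h b j u * frameCurvature Γ b i j u +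
      β * (h b j u * (pd i (K b j) u - pd j (K b i) u +
        ∑ c, ∑ d, eps b c d * (Γ c i u * K d j u - Γ c j u * K d i u))) +
      β ^ 2 * ∑ c, ∑ d, eps b c d * (K c i u * (h b j u * K d j u)) := by
    intro b j
    have h5 : ∑ c, ∑ d, eps b c d * A c i u * A d j u =
        ∑ c, ∑ d, eps b c d * Γ c i u * Γ d j u +
        β * (∑ c, ∑ d, eps b c d * (Γ c i u * K d j u - Γ c j u * K d i u)) +
        β ^ 2 * ∑ c, ∑ d, eps b c d * (K c i u * K d j u) := by
      simp only [hA]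
      obtain rfl | rfl | rfl := fin_three_cases b <;> norm_num [Fin.sum_univ_three, eps] <;> ring
    have h6 : ∑ c, ∑ d, eps b c d * (K c i u * (h b j u * K d j u)) =
        h b j u * ∑ c, ∑ d, eps b c d * (K c i u * K d j u) := by
      simp only [Finset.mul_sum]
      exact Finset.sum_congr rfl fun c _ => Finset.sum_congr rfl fun d _ => by ring
    rw [h6, frameCurvature, frameCurvature, h5, hpd, hpd]
    ring
  have h7 : ∑ b, ∑ j, ∑ c, ∑ d, eps b c d * (K c i u * (h b j u * K d j u)) = 0 := by
    rw [← h3]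
    refine Finset.sum_congr rfl fun b _ => ?_
    rw [Finset.sum_comm]
    refine Finset.sum_congr rfl fun c _ => ?_
    rw [Finset.sum_comm]
    refine Finset.sum_congr rfl fun d _ => ?_
    rw [Finset.mul_sum, Finset.mul_sum]
  simp only [h4, Finset.sum_add_distrib, ← Finset.mul_sum, h1, h2, h7]
  ring

/-- The frame is parallel: `∂_k e_a^n + C^n_{kl} e_a^l = ε_{da}^b Γ^d_k e_b^n`. -/
theorem pd_frame (he : ∀ a i, DifferentiableAt ℝ (e a i) u)
    (hh : ∀ a i, DifferentiableAt ℝ (h a i) u)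
    (hhe : ∀ i j, ∑ b, h b i u * e b j u = if i = j then 1 else 0)
    (heh : ∀ᶠ y in 𝓝 u, ∀ a b, ∑ l, h a l y * e b l y = if a = b then 1 else 0)
    (hC : ∀ c i j, ∑ k, e c k u * C k i j =
      pd i (e c j) u + ∑ b, ∑ a, eps b a c * (Γ b i u * e a j u)) (k a n : Fin 3) :
    pd k (h a n) u = -∑ l, C n k l * h a l u + ∑ d, ∑ b, eps d a b * (Γ d k u * h b n u) := by
  -- Derivative of the duality relation `h_a^l e^b_l = δ_a^b`, which holds near `u`.
  have h1 : ∀ b, ∑ l, (pd k (h a l) u * e b l u + h a l u * pd k (e b l) u) = 0 := by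
    intro b
    have h2 : pd k (fun y => ∑ l, h a l y * e b l y) u = 0 := by
      rw [pd_congr (g := fun _ => if a = b then 1 else 0) (heh.mono fun y hy => hy a b), pd_const]
    rw [pd_sum fun l _ => (hh a l).fun_mul (he b l)] at h2
    rw [← h2]
    exact Finset.sum_congr rfl fun l _ => (pd_mul (hh a l) (he b l) k).symm
  have h3 : ∀ b, ∑ l, pd k (h a l) u * e b l u =
      -∑ l, h a l u * ∑ m, e b m u * C m k l +
        ∑ d, ∑ c, eps d c b * (Γ d k u * ∑ l, h a l u * e c l u) := by
    intro b
    have h4 := h1 b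
    simp only [hC, Fin.sum_univ_three] at h4 ⊢
    linear_combination h4
  have h5 : ∀ b, ∑ l, pd k (h a l) u * e b l u =
      -∑ l, h a l u * ∑ m, e b m u * C m k l + ∑ d, eps d a b * Γ d k u := by
    intro b
    rw [h3]
    simp [heh.self_of_nhds a _]
  -- Contracting with the frame inverts the coframe matrix and isolates the derivative of `h`.
  have h6 : ∑ b, h b n u * ∑ l, pd k (h a l) u * e b l u =
      ∑ b, h b n u * (-∑ l, h a l u * ∑ m, e b m u * C m k l + ∑ d, eps d a b * Γ d k u) :=
    Finset.sum_congr rfl fun b _ => by rw [h5]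
  have e0 := hhe n 0
  have e1 := hhe n 1
  have e2 := hhe n 2
  simp only [Fin.sum_univ_three] at e0 e1 e2 h6 ⊢
  obtain rfl | rfl | rfl := fin_three_cases n <;> simp at e0 e1 e2 ⊢ <;>
    linear_combination h6 - (pd k (h a 0) u + C 0 k 0 * h a 0 u + C 0 k 1 * h a 1 u +
        C 0 k 2 * h a 2 u) * e0 - (pd k (h a 1) u + C 1 k 0 * h a 0 u + C 1 k 1 * h a 1 u +
        C 1 k 2 * h a 2 u) * e1 - (pd k (h a 2) u + C 2 k 0 * h a 0 u + C 2 k 1 * h a 1 u +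
        C 2 k 2 * h a 2 u) * e2

/-- The inverse metric `q^{lj} = ∑_a e_a^l e_a^j`. -/
def inverseMetric (h : Fin 3 → Fin 3 → E3 → ℝ) (l j : Fin 3) (y : E3) : ℝ :=
  ∑ a, h a l y * h a j y

/-- The inverse metric is parallel. -/
theorem pd_inverseMetric (hh : ∀ a i, DifferentiableAt ℝ (h a i) u)
    (hpd : ∀ k a n, pd k (h a n) u =
      -∑ l, C n k l * h a l u + ∑ d, ∑ b, eps d a b * (Γ d k u * h b n u)) (k l j : Fin 3) :
    pd k (inverseMetric h l j) u =
      -∑ m, (C l k m * inverseMetric h m j u + C j k m * inverseMetric h l m u) := by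
  unfold inverseMetric
  rw [pd_sum fun a _ => (hh a l).fun_mul (hh a j)]
  simp only [pd_mul (hh _ l) (hh _ j), hpd]
  -- The spin connection terms cancel: `ε_{dab}` is antisymmetric in `a` and `b`, while the sum over
  -- the frame is symmetric.
  norm_num [Fin.sum_univ_three, eps]
  ring

/-- The Riemannian density `|det e|` is parallel. -/
theorem pd_abs_det_coframe {s : E3 → ℝ} (he : ∀ a i, DifferentiableAt ℝ (e a i) u)
    (hhe : ∀ i j, ∑ b, h b i u * e b j u = if i = j then 1 else 0)
    (heh : ∀ a b, ∑ l, h a l u * e b l u = if a = b then 1 else 0)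
    (hC : ∀ c i j, ∑ k, e c k u * C k i j =
      pd i (e c j) u + ∑ b, ∑ a, eps b a c * (Γ b i u * e a j u))
    (hs : ∀ᶠ y in 𝓝 u, s y = |(Matrix.of fun b i => e b i y).det|) (k : Fin 3) :
    DifferentiableAt ℝ s u ∧ s u ≠ 0 ∧ pd k s u = s u * ∑ m, C m k m := by
  set D : E3 → ℝ := fun y => (Matrix.of fun b i => e b i y).det with hD
  have hD0 : D u ≠ 0 := det_coframe_ne_zero hhe
  have hDexp : D = fun y => e 0 0 y * e 1 1 y * e 2 2 y - e 0 0 y * e 1 2 y * e 2 1 y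
      - e 0 1 y * e 1 0 y * e 2 2 y + e 0 1 y * e 1 2 y * e 2 0 y
      + e 0 2 y * e 1 0 y * e 2 1 y - e 0 2 y * e 1 1 y * e 2 0 y := by
    funext y
    simp [hD, Matrix.det_fin_three]
  have hDd : DifferentiableAt ℝ D u := by
    rw [hDexp]
    fun_prop
  have hsd : DifferentiableAt ℝ s u := (hDd.abs hD0).congr_of_eventuallyEq hs
  have hsu : s u = |D u| := hs.self_of_nhds
  have hs0 : s u ≠ 0 := by rw [hsu]; exact abs_ne_zero.2 hD0
  have hpdD : pd k D u = D u * ∑ m, C m k m := by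
    have hadj := adjugate_coframe hhe
    have h1 : ∀ b j, D u * h b j u = (Matrix.of fun b i => e b i u).adjugate j b := by
      intro b j
      rw [hadj]
      rfl
    -- Jacobi's formula for the derivative of a determinant, with cofactors written as `D * h`.
    have h2 : pd k D u = ∑ b, ∑ j, D u * h b j u * pd k (e b j) u := by
      simp only [h1, Matrix.adjugate_fin_three]
      have h3 : ∀ a b c i j l, DifferentiableAt ℝ (fun y => e a i y * e b j y * e c l y) u :=
        fun a b c i j l => by fun_prop
      have h4 : ∀ a b c i j l, pd k (fun y => e a i y * e b j y * e c l y) u =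
          pd k (e a i) u * e b j u * e c l u + e a i u * pd k (e b j) u * e c l u +
            e a i u * e b j u * pd k (e c l) u := by
        intro a b c i j l
        rw [pd_mul ((he a i).fun_mul (he b j)) (he c l), pd_mul (he a i) (he b j)]
        ring
      rw [hDexp, pd_sub (by fun_prop) (by fun_prop), pd_add (by fun_prop) (by fun_prop),
        pd_add (by fun_prop) (by fun_prop), pd_sub (by fun_prop) (by fun_prop),
        pd_sub (by fun_prop) (by fun_prop)]
      simp only [h4]
      simp [Fin.sum_univ_three]
      ring
    have h5 : ∑ b, ∑ j, h b j u * pd k (e b j) u = ∑ m, C m k m := by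
      have h6 : ∀ b j, pd k (e b j) u =
          ∑ m, e b m u * C m k j - ∑ d, ∑ a, eps d a b * (Γ d k u * e a j u) := by
        intro b j
        rw [hC]
        ring
      have h7 : ∑ b, ∑ j, h b j u * ∑ m, e b m u * C m k j = ∑ m, C m k m := by
        calc ∑ b, ∑ j, h b j u * ∑ m, e b m u * C m k j
            = ∑ j, ∑ m, (∑ b, h b j u * e b m u) * C m k j := by
              simp only [Fin.sum_univ_three]
              ring
          _ = _ := by simp [hhe]
      -- The spin connection is antisymmetric in its frame indices, hence trace-free.
      have h8 : ∑ b, ∑ j, h b j u * ∑ d, ∑ a, eps d a b * (Γ d k u * e a j u) = 0 := by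
        calc ∑ b, ∑ j, h b j u * ∑ d, ∑ a, eps d a b * (Γ d k u * e a j u)
            = ∑ b, ∑ d, ∑ a, eps d a b * (Γ d k u * ∑ j, h b j u * e a j u) := by
              simp only [Fin.sum_univ_three]
              ring
          _ = 0 := by simp [heh, eps]
      simp only [h6, mul_sub, Finset.sum_sub_distrib]
      rw [h7, h8, sub_zero]
    rw [h2, ← h5]
    simp only [Finset.mul_sum, mul_assoc]
  refine ⟨hsd, hs0, ?_⟩
  -- Differentiating `s² = D²` gives the derivative of `s = |D|` without knowing the sign of `D`.
  have hsq : (fun y => s y * s y) =ᶠ[𝓝 u] fun y => D y * D y :=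
    hs.mono fun y hy => by
      change s y * s y = D y * D y
      rw [hy, abs_mul_abs_self]
  have h9 := pd_congr hsq k
  rw [pd_mul hsd hsd, pd_mul hDd hDd, hpdD] at h9
  have h10 : s u * s u = D u * D u := hsq.self_of_nhds
  refine mul_left_cancel₀ hs0 ?_
  linear_combination h9 / 2 - (∑ m, C m k m) * h10

/-- The covariant divergence of the momentum density is the contracted Codazzi expression. -/
theorem divergence_momentum {s : E3 → ℝ} {q P : Fin 3 → Fin 3 → E3 → ℝ} (c : ℝ)
    (hW : ∀ i j, DifferentiableAt ℝ (W i j) u)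
    (hq : ∀ i j, DifferentiableAt ℝ (q i j) u) (hs : DifferentiableAt ℝ s u)
    (hCs : ∀ k i j, C k i j = C k j i)
    (hpdq : ∀ k l j, pd k (q l j) u = -∑ m, (C l k m * q m j u + C j k m * q l m u))
    (hpds : ∀ k, pd k s u = s u * ∑ m, C m k m)
    (hP : ∀ᶠ y in 𝓝 u, ∀ k j, P k j y =
      c * (s y * (∑ l, q l j y * W l k y - q k j y * ∑ l, W l l y))) (j : Fin 3) :
    ∑ k, (pd k (P k j) u + ∑ l, (C k k l * P l j u + C j k l * P k l u - C l l k * P k j u)) =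
      -(c * s u) * ∑ l, q l j u * frameCodazzi C W l u := by
  have hS : ∀ k j, DifferentiableAt ℝ (fun y => ∑ l, q l j y * W l k y) u := fun k j =>
    DifferentiableAt.fun_sum fun l _ => (hq l j).mul (hW l k)
  have ht : DifferentiableAt ℝ (fun y => ∑ l, W l l y) u :=
    DifferentiableAt.fun_sum fun l _ => hW l l
  have hpdP : ∀ k, pd k (P k j) u = c * (pd k s u * (∑ l, q l j u * W l k u -
      q k j u * ∑ l, W l l u) + s u * (∑ l, (pd k (q l j) u * W l k u + q l j u * pd k (W l k) u) -
      (pd k (q k j) u * ∑ l, W l l u + q k j u * ∑ l, pd k (W l l) u))) := by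
    intro k
    rw [pd_congr (hP.mono fun y hy => hy k j),
      pd_const_mul (hs.fun_mul ((hS k j).fun_sub ((hq k j).fun_mul ht))),
      pd_mul hs ((hS k j).fun_sub ((hq k j).fun_mul ht)),
      pd_sub (hS k j) ((hq k j).fun_mul ht), pd_mul (hq k j) ht, pd_sum fun l _ => hW l l,
      pd_sum fun l _ => (hq l j).fun_mul (hW l k)]
    simp only [pd_mul (hq _ j) (hW _ k)]
  -- Inserting the parallelism of `s` and `q`, all terms in their derivatives cancel against the
  -- symbols `C` of the divergence. The symmetry of `C` is needed for this cancellation and fixes an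
  -- index order for `ring`.
  simp only [hpdP, hP.self_of_nhds _ _, hpdq, hpds, frameCodazzi, Fin.sum_univ_three,
    hCs _ 1 0, hCs _ 2 0, hCs _ 2 1]
  ring

end CoordinateTensors

/-! ### Coordinate components of 1-forms. -/

section Forms

variable {M : Type*} [TopologicalSpace M] [ChartedSpace E3 M]

/-- The components `α_i` of a 1-form in the chart `φ`, as functions on `ℝ³`. -/
def formComp (φ : OpenPartialHomeomorph M E3) (α : (x : M) → TangentSpace I3 x →L[ℝ] ℝ)
    (i : Fin 3) (u : E3) : ℝ :=
  α (φ.symm u) (coordVec φ i (φ.symm u))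

theorem formComp_chart {φ : OpenPartialHomeomorph M E3} {x : M} (hx : x ∈ φ.source)
    (α : (x : M) → TangentSpace I3 x →L[ℝ] ℝ) (i : Fin 3) :
    formComp φ α i (φ x) = α x (coordVec φ i x) :=
  congrArg (fun y => α y (coordVec φ i y)) (φ.left_inv hx)

omit [ChartedSpace E3 M] in
theorem eventually_mem_target {φ : OpenPartialHomeomorph M E3} {x : M} (hx : x ∈ φ.source) :
    ∀ᶠ y in 𝓝 (φ x), y ∈ φ.target :=
  φ.open_target.mem_nhds (φ.map_source hx)

theorem fieldStrength_eq_frameCurvature (A : (x : M) → TangentSpace I3 x →L[ℝ] su2)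
    {φ : OpenPartialHomeomorph M E3} {x : M} (hx : x ∈ φ.source) (a i j : Fin 3) :
    fieldStrength A φ a i j x =
      frameCurvature (fun a i => formComp φ (comp A a) i) a i j (φ x) := by
  simp only [fieldStrength, frameCurvature, formComp_chart hx]
  rfl

theorem wedge_apply {V : Type*} [AddCommGroup V] [Module ℝ V] (α β : V →ₗ[ℝ] ℝ) (v w : V) :
    wedge α β ![v, w] = α v * β w - β v * α w := by
  exact (Matrix.det_fin_two (fun i => LinearMap.pi ![α, β] (![v, w] i))).trans (by simp)

end Forms

/-! ### Frame and coframe in a chart; the Levi-Civita connection in components. -/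

section FrameComponents

variable {M : Type*} [TopologicalSpace M] [ChartedSpace E3 M] [IsManifold I3 ∞ M]
  [RiemannianBundle (fun x : M => TangentSpace I3 x)]
  {o : (x : M) → Orientation ℝ (TangentSpace I3 x) (Fin 3)}
  {φ : OpenPartialHomeomorph M E3} {x : M}

theorem coframe_frame (e : Dreibein o) (a b : Fin 3) (x : M) :
    coframe e a x (e.frame x b) = if a = b then 1 else 0 := by
  simp [coframe, orthonormal_iff_ite.1 (e.frame x).orthonormal]

theorem sum_coframe_smul_frame (e : Dreibein o) (x : M) (v : TangentSpace I3 x) :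
    ∑ a, coframe e a x v • e.frame x a = v :=
  (e.frame x).sum_repr' v

/-- The components `e_a^i` of the frame in the chart `φ`, as functions on `ℝ³`. -/
def frameComp (e : Dreibein o) (φ : OpenPartialHomeomorph M E3) (a i : Fin 3) (u : E3) : ℝ :=
  coordForm φ i (φ.symm u) (e.frame (φ.symm u) a)

/-- The components `e^a_i` of the coframe in the chart `φ`, as functions on `ℝ³`. -/
abbrev coframeComp (e : Dreibein o) (φ : OpenPartialHomeomorph M E3) (a : Fin 3) :
    Fin 3 → E3 → ℝ :=
  formComp φ (coframe e a)

theorem frameComp_chart (e : Dreibein o) (hx : x ∈ φ.source) (a i : Fin 3) :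
    frameComp e φ a i (φ x) = coordForm φ i x (e.frame x a) :=
  congrArg (fun y => coordForm φ i y (e.frame y a)) (φ.left_inv hx)

theorem sum_frameComp_mul_formComp (e : Dreibein o) (hφ : φ ∈ IsManifold.maximalAtlas I3 ∞ M)
    (hx : x ∈ φ.source) (α : (x : M) → TangentSpace I3 x →L[ℝ] ℝ) (a : Fin 3) :
    ∑ i, frameComp e φ a i (φ x) * formComp φ α i (φ x) = α x (e.frame x a) := by
  simp only [frameComp_chart e hx, formComp_chart hx]
  conv_rhs => rw [← sum_coordForm_smul_coordVec hφ hx (e.frame x a)]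
  rw [map_sum]
  simp only [map_smul, smul_eq_mul]

theorem sum_frameComp_mul_coframeComp (e : Dreibein o)
    (hφ : φ ∈ IsManifold.maximalAtlas I3 ∞ M) {u : E3} (hu : u ∈ φ.target) (i j : Fin 3) :
    ∑ b, frameComp e φ b i u * coframeComp e φ b j u = if i = j then 1 else 0 := by
  have hx := φ.map_target hu
  rw [← coordForm_coordVec hφ hx]
  conv_rhs => rw [← sum_coframe_smul_frame e _ (coordVec φ j (φ.symm u))]
  rw [map_sum]
  simp only [map_smul, smul_eq_mul, frameComp, coframeComp, formComp]
  exact Finset.sum_congr rfl fun b _ => mul_comm _ _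

theorem sum_frameComp_mul_coframeComp' (e : Dreibein o)
    (hφ : φ ∈ IsManifold.maximalAtlas I3 ∞ M) {u : E3} (hu : u ∈ φ.target) (a b : Fin 3) :
    ∑ i, frameComp e φ a i u * coframeComp e φ b i u = if a = b then 1 else 0 := by
  have h := sum_frameComp_mul_formComp e hφ (φ.map_target hu) (coframe e b) a
  rw [φ.right_inv hu, coframe_frame] at h
  simp only [h, eq_comm]

variable [IsContMDiffRiemannianBundle I3 ∞ E3 (fun x : M => TangentSpace I3 x)]

theorem contMDiffAt_coframe_coordVec (e : Dreibein o) (hφ : φ ∈ IsManifold.maximalAtlas I3 ∞ M)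
    (hx : x ∈ φ.source) (a i : Fin 3) :
    ContMDiffAt I3 𝓘(ℝ) ∞ (fun y => coframe e a y (coordVec φ i y)) x :=
  (e.smooth a x).inner_bundle (contMDiffAt_coordVec hφ hx i)

theorem contDiffAt_coframeComp (e : Dreibein o) (hφ : φ ∈ IsManifold.maximalAtlas I3 ∞ M)
    (hx : x ∈ φ.source) (a i : Fin 3) : ContDiffAt ℝ ∞ (coframeComp e φ a i) (φ x) :=
  contDiffAt_comp_chart_symm hφ hx (contMDiffAt_coframe_coordVec e hφ hx a i)

/-- Expand `∂_i` in the frame. Smoothness is assumed on the frame fields because they are global,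
which is what the definition of an Ashtekar connection tests, whereas coordinate fields are only
local. -/
theorem contMDiffAt_form_coordVec (e : Dreibein o) (hφ : φ ∈ IsManifold.maximalAtlas I3 ∞ M)
    (hx : x ∈ φ.source) {α : (x : M) → TangentSpace I3 x →L[ℝ] ℝ}
    (hα : ∀ a, ContMDiff I3 𝓘(ℝ) ∞ fun y => α y (e.frame y a)) (i : Fin 3) :
    ContMDiffAt I3 𝓘(ℝ) ∞ (fun y => α y (coordVec φ i y)) x := by
  have h : (fun y => α y (coordVec φ i y)) =
      fun y => ∑ a, coframe e a y (coordVec φ i y) * α y (e.frame y a) := by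
    funext y
    conv_lhs => rw [← sum_coframe_smul_frame e y (coordVec φ i y), map_sum]
    simp only [map_smul, smul_eq_mul]
  rw [h]
  exact ContMDiffAt.sum fun a _ => (contMDiffAt_coframe_coordVec e hφ hx a i).mul (hα a x)

theorem contDiffAt_formComp (e : Dreibein o) (hφ : φ ∈ IsManifold.maximalAtlas I3 ∞ M)
    (hx : x ∈ φ.source) {α : (x : M) → TangentSpace I3 x →L[ℝ] ℝ}
    (hα : ∀ a, ContMDiff I3 𝓘(ℝ) ∞ fun y => α y (e.frame y a)) (i : Fin 3) :
    ContDiffAt ℝ ∞ (formComp φ α i) (φ x) :=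
  contDiffAt_comp_chart_symm hφ hx (contMDiffAt_form_coordVec e hφ hx hα i)

/-- Cramer's rule: near the point the frame matrix is the adjugate of the coframe matrix divided by
its determinant, and the coframe components are already known to be smooth. -/
theorem differentiableAt_frameComp (e : Dreibein o) (hφ : φ ∈ IsManifold.maximalAtlas I3 ∞ M)
    (hx : x ∈ φ.source) (a i : Fin 3) : DifferentiableAt ℝ (frameComp e φ a i) (φ x) := by
  have he : ∀ a i, DifferentiableAt ℝ (coframeComp e φ a i) (φ x) := fun a i =>
    (contDiffAt_coframeComp e hφ hx a i).differentiableAt (by simp)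
  have h : frameComp e φ a i =ᶠ[𝓝 (φ x)] fun y =>
      (Matrix.of fun b i => coframeComp e φ b i y).adjugate i a /
        (Matrix.of fun b i => coframeComp e φ b i y).det := by
    filter_upwards [eventually_mem_target hx] with y hy
    have h1 := sum_frameComp_mul_coframeComp e hφ hy
    rw [adjugate_coframe h1, eq_div_iff (det_coframe_ne_zero h1), mul_comm]
    rfl
  have hn : DifferentiableAt ℝ
      (fun y => (Matrix.of fun b i => coframeComp e φ b i y).adjugate i a) (φ x) := by
    simp only [Matrix.adjugate_fin_three]
    obtain rfl | rfl | rfl := fin_three_cases a <;> obtain rfl | rfl | rfl := fin_three_cases i <;>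
      simp <;> fun_prop
  have hd : DifferentiableAt ℝ
      (fun y => (Matrix.of fun b i => coframeComp e φ b i y).det) (φ x) := by
    simp only [Matrix.det_fin_three, Matrix.of_apply]
    fun_prop
  have hd0 := det_coframe_ne_zero (sum_frameComp_mul_coframeComp e hφ (φ.map_source hx))
  have hq := DifferentiableAt.fun_mul (𝕜 := ℝ) hn (DifferentiableAt.fun_inv (𝕜 := ℝ) hd hd0)
  exact hq.congr_of_eventuallyEq (by simpa only [div_eq_mul_inv] using h)

omit [IsContMDiffRiemannianBundle I3 ∞ E3 (fun x : M => TangentSpace I3 x)] in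
theorem comp_spinConnection_frame (e : Dreibein o) (c d : Fin 3) (x : M) :
    comp (spinConnection e) c x (e.frame x d) =
      (1 / 2) * ∑ a, ∑ b, eps c a b * koszul e d a b x := by
  simp only [comp, spinConnection, coframe, ContinuousLinearMap.comp_apply,
    _root_.sum_apply, _root_.smul_apply, ContinuousLinearMap.smulRight_apply, map_sum, map_smul,
    su2Coord_tau, innerSL_apply_apply, orthonormal_iff_ite.1 (e.frame x).orthonormal]
  simp

theorem contMDiff_koszul (e : Dreibein o) (d a b : Fin 3) :
    ContMDiff I3 𝓘(ℝ) ∞ (koszul e d a b) := by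
  -- The bracket costs one derivative, which is harmless since `∞ + 1 = ∞`.
  have : IsManifold I3 (((⊤ : ℕ∞) : WithTop ℕ∞) + 1) M := ‹IsManifold I3 ∞ M›
  have : IsManifold I3 (minSmoothness ℝ 2) M := IsManifold.of_le (n := ∞) (by
    rw [minSmoothness_of_isRCLikeNormedField]
    exact WithTop.coe_le_coe.2 le_top)
  have hL : ∀ a b, ContMDiff I3 I3.tangent ∞ (fun y => (⟨y, VectorField.mlieBracket I3
      (fun y => e.frame y a) (fun y => e.frame y b) y⟩ : TangentBundle I3 M)) := fun a b y =>
    ContMDiffAt.mlieBracket_vectorField (n := ⊤) (m := ⊤) (e.smooth a y) (e.smooth b y) (by simp)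
  unfold koszul
  exact contMDiff_const.mul ((((hL d a).inner_bundle (e.smooth b)).sub
    ((hL d b).inner_bundle (e.smooth a))).sub ((hL a b).inner_bundle (e.smooth d)))

theorem contMDiff_spinConnection_frame (e : Dreibein o) (c d : Fin 3) :
    ContMDiff I3 𝓘(ℝ) ∞ fun y => comp (spinConnection e) c y (e.frame y d) := by
  simp only [comp_spinConnection_frame]
  exact contMDiff_const.mul (ContMDiff.sum fun a _ => ContMDiff.sum fun b _ =>
    contMDiff_const.mul (contMDiff_koszul e d a b))

theorem coframe_inducedCov_coordVec (e : Dreibein o) (A : (x : M) → TangentSpace I3 x →L[ℝ] su2)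
    (hφ : φ ∈ IsManifold.maximalAtlas I3 ∞ M) (hx : x ∈ φ.source) (c i j : Fin 3) :
    coframe e c x (inducedCov e A (fun y => coordVec φ j y) x (coordVec φ i x)) =
      pd i (coframeComp e φ c j) (φ x) +
        ∑ b, ∑ a, eps b a c * (formComp φ (comp A b) i (φ x) * coframeComp e φ a j (φ x)) := by
  have hd : ∀ c, mvfderiv I3 (fun y => ⟪e.frame y c, coordVec φ j y⟫_ℝ) x (coordVec φ i x) =
      pd i (coframeComp e φ c j) (φ x) := fun c =>
    mvfderiv_apply_coordVec hφ hx
      ((contMDiffAt_coframe_coordVec e hφ hx c j).mdifferentiableAt (by simp)) i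
  change coframe e c x (inducedCovFun e A (fun y => coordVec φ j y) x (coordVec φ i x)) = _
  simp only [inducedCovFun, _root_.sum_apply, ContinuousLinearMap.smulRight_apply, map_sum,
    map_smul, coframe_frame, _root_.add_apply, _root_.smul_apply, smul_eq_mul, hd]
  simp only [mul_ite, mul_one, mul_zero, Finset.sum_ite_eq, Finset.mem_univ, if_true, coframeComp,
    formComp_chart hx]
  congr 1
  refine Finset.sum_congr rfl fun b _ => Finset.sum_congr rfl fun a _ => ?_
  rw [mul_assoc, mul_comm (comp A b x (coordVec φ i x))]
  rfl

/-- Since `[∂_i, ∂_j] = 0`, torsion-freeness says that `D_{∂_i} ∂_j` is symmetric in `i` and `j`;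
its frame components give the expression in question. -/
theorem frameTorsion_eq_zero (e : Dreibein o) (A : (x : M) → TangentSpace I3 x →L[ℝ] su2)
    (hφ : φ ∈ IsManifold.maximalAtlas I3 ∞ M) (hT : (inducedCov e A).torsion = 0)
    {u : E3} (hu : u ∈ φ.target) (c i j : Fin 3) :
    frameTorsion (fun a i => coframeComp e φ a i) (fun a i => formComp φ (comp A a) i) c i j u
      = 0 := by
  have hx := φ.map_target hu
  have h := (CovariantDerivative.torsion_eq_zero_iff (inducedCov e A)).1 hT
    ((contMDiffAt_coordVec hφ hx i).mdifferentiableAt (by simp))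
    ((contMDiffAt_coordVec hφ hx j).mdifferentiableAt (by simp))
  rw [mlieBracket_coordVec hφ hx] at h
  have h2 := congrArg (coframe e c _) h
  rw [map_sub, map_zero, coframe_inducedCov_coordVec e A hφ hx,
    coframe_inducedCov_coordVec e A hφ hx, φ.right_inv hu] at h2
  rw [← h2, frameTorsion]
  simp only [mul_sub, Finset.sum_sub_distrib]
  ring

/-- The tetrad postulate: both sides are the frame component `e^c(∇_{∂_i} ∂_j)`, once through the
Christoffel symbols and once through the spin connection. -/
theorem sum_coframeComp_mul_christoffel (e : Dreibein o)
    (hφ : φ ∈ IsManifold.maximalAtlas I3 ∞ M) (hx : x ∈ φ.source) (c i j : Fin 3) :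
    ∑ k, coframeComp e φ c k (φ x) * christoffel e φ k i j x =
      pd i (coframeComp e φ c j) (φ x) + ∑ b, ∑ a, eps b a c *
        (formComp φ (comp (spinConnection e) b) i (φ x) * coframeComp e φ a j (φ x)) := by
  rw [← coframe_inducedCov_coordVec e _ hφ hx]
  simp only [christoffel, coframeComp, formComp_chart hx]
  conv_rhs => rw [← sum_coordForm_smul_coordVec hφ hx
    (inducedCov e (spinConnection e) (fun y => coordVec φ j y) x (coordVec φ i x)), map_sum]
  simp only [map_smul, smul_eq_mul]
  exact Finset.sum_congr rfl fun k _ => mul_comm _ _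

theorem christoffel_symm (e : Dreibein o) (hφ : φ ∈ IsManifold.maximalAtlas I3 ∞ M)
    (hx : x ∈ φ.source) (k i j : Fin 3) : christoffel e φ k i j x = christoffel e φ k j i x := by
  have h := (CovariantDerivative.torsion_eq_zero_iff (leviCivita e)).1 (leviCivita_torsion e)
    ((contMDiffAt_coordVec hφ hx i).mdifferentiableAt (by simp))
    ((contMDiffAt_coordVec hφ hx j).mdifferentiableAt (by simp))
  rw [mlieBracket_coordVec hφ hx, sub_eq_zero] at h
  rw [christoffel, christoffel, h]

end FrameComponents

/-! ### Hodge star and inner product of 2-forms in an oriented orthonormal basis. -/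

section OrthonormalFrames

variable {V : Type*} [NormedAddCommGroup V] [InnerProductSpace ℝ V]

/-- The metric trace of a bilinear form does not depend on the orthonormal basis. This allows the
dreibein to replace the standard basis used in the definitions. -/
theorem sum_bilinear_orthonormalBasis {ι κ : Type*} [Fintype ι] [Fintype κ]
    (u : OrthonormalBasis ι ℝ V) (v : OrthonormalBasis κ ℝ V) (B : V →ₗ[ℝ] V →ₗ[ℝ] ℝ) :
    ∑ i, B (u i) (u i) = ∑ k, B (v k) (v k) := by
  classical
  have h : ∀ i, B (u i) (u i) = ∑ k, ∑ l, ⟪v k, u i⟫_ℝ * ⟪v l, u i⟫_ℝ * B (v l) (v k) := by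
    intro i
    conv_lhs => rw [← v.sum_repr' (u i)]
    simp only [map_sum, map_smul, LinearMap.sum_apply, LinearMap.smul_apply, smul_eq_mul,
      Finset.mul_sum, mul_assoc]
  have h2 : ∀ k l, ∑ i, ⟪v k, u i⟫_ℝ * ⟪v l, u i⟫_ℝ = ⟪v k, v l⟫_ℝ := by
    intro k l
    rw [← u.sum_inner_mul_inner]
    simp only [real_inner_comm]
  simp only [h]
  rw [Finset.sum_comm]
  refine Finset.sum_congr rfl fun k _ => ?_
  rw [Finset.sum_comm]
  simp only [← Finset.sum_mul, h2, orthonormal_iff_ite.1 v.orthonormal]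
  simp

/-- A 2-form as a bilinear map. -/
def twoFormBilin (σ : V [⋀^Fin 2]→ₗ[ℝ] ℝ) : V →ₗ[ℝ] V →ₗ[ℝ] ℝ :=
  LinearMap.mk₂ ℝ (fun v w => σ ![v, w])
    (fun v v' w => by simpa using σ.map_vecCons_add ![w] v v')
    (fun c v w => by simpa using σ.map_vecCons_smul ![w] c v)
    (fun v w w' => by
      have h := (σ.curryLeft v).map_vecCons_add ![] w w'
      simpa using h)
    (fun c v w => by
      have h := (σ.curryLeft v).map_vecCons_smul ![] c w
      simpa using h)

theorem twoFormBilin_apply (σ : V [⋀^Fin 2]→ₗ[ℝ] ℝ) (v w : V) :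
    twoFormBilin σ v w = σ ![v, w] := rfl

theorem twoForm_swap (σ : V [⋀^Fin 2]→ₗ[ℝ] ℝ) (v w : V) : σ ![v, w] = -σ ![w, v] := by
  have h := σ.map_swap ![v, w] (i := 0) (j := 1) (by simp)
  rw [← neg_eq_iff_eq_neg, ← h]
  congr 1
  ext i
  fin_cases i <;> rfl

variable [FiniteDimensional ℝ V]

theorem innerTwoForm_eq_sum (b : OrthonormalBasis (Fin 3) ℝ V) (σ η : V [⋀^Fin 2]→ₗ[ℝ] ℝ) :
    innerTwoForm σ η = (1 / 2) * ∑ i, ∑ j, σ ![b i, b j] * η ![b i, b j] := by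
  have h1 : ∀ v : V, ∑ j, σ ![v, stdOrthonormalBasis ℝ V j] * η ![v, stdOrthonormalBasis ℝ V j] =
      ∑ j, σ ![v, b j] * η ![v, b j] := fun v =>
    sum_bilinear_orthonormalBasis (stdOrthonormalBasis ℝ V) b
      ((LinearMap.mul ℝ ℝ).compl₁₂ (twoFormBilin σ v) (twoFormBilin η v))
  have h2 : ∀ w : V, ∑ j, σ ![stdOrthonormalBasis ℝ V j, w] * η ![stdOrthonormalBasis ℝ V j, w] =
      ∑ j, σ ![b j, w] * η ![b j, w] := fun w =>
    sum_bilinear_orthonormalBasis (stdOrthonormalBasis ℝ V) b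
      ((LinearMap.mul ℝ ℝ).compl₁₂ ((twoFormBilin σ).flip w) ((twoFormBilin η).flip w))
  unfold innerTwoForm
  simp only [h1]
  rw [Finset.sum_comm]
  simp only [h2]
  rw [Finset.sum_comm]

variable [Fact (finrank ℝ V = 3)]

omit [FiniteDimensional ℝ V] in
theorem volumeForm_orthonormalBasis (o : Orientation ℝ V (Fin 3))
    (b : OrthonormalBasis (Fin 3) ℝ V) (hb : b.toBasis.orientation = o) (c m n : Fin 3) :
    o.volumeForm ![b c, b m, b n] = eps c m n := by
  rw [o.volumeForm_robust b hb, Basis.det_apply, Matrix.det_fin_three]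
  have h : ∀ i j, b.toBasis.toMatrix ![b c, b m, b n] i j =
      if i = (![c, m, n] j) then 1 else 0 := by
    intro i j
    rw [Basis.toMatrix_apply, OrthonormalBasis.coe_toBasis_repr_apply, b.repr_apply_apply]
    fin_cases j <;> exact orthonormal_iff_ite.1 b.orthonormal i _
  simp only [h]
  obtain rfl | rfl | rfl := fin_three_cases c <;> obtain rfl | rfl | rfl := fin_three_cases m <;>
    obtain rfl | rfl | rfl := fin_three_cases n <;> simp [eps] <;> norm_num

theorem hodgeStar_orthonormalBasis (o : Orientation ℝ V (Fin 3))
    (b : OrthonormalBasis (Fin 3) ℝ V) (hb : b.toBasis.orientation = o) (c m n : Fin 3) :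
    hodgeStar o (innerSL ℝ (b c)).toLinearMap ![b m, b n] = eps c m n := by
  have h : ∑ i, (innerSL ℝ (b c)).toLinearMap (stdOrthonormalBasis ℝ V i) •
      stdOrthonormalBasis ℝ V i = b c := by
    rw [← (stdOrthonormalBasis ℝ V).sum_repr' (b c)]
    refine Finset.sum_congr rfl fun i _ => ?_
    rw [(stdOrthonormalBasis ℝ V).sum_repr' (b c)]
    simp [real_inner_comm]
  rw [hodgeStar, h, AlternatingMap.curryLeft_apply_apply]
  exact volumeForm_orthonormalBasis o b hb c m n

/-- Contracting `½ ε_{abc} ⟨σ^b, ⋆e^c⟩` gives `½ σ^b(e_a, e_b)`. -/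
theorem sum_eps_innerTwoForm_hodgeStar (o : Orientation ℝ V (Fin 3))
    (b : OrthonormalBasis (Fin 3) ℝ V) (hb : b.toBasis.orientation = o)
    (σ : Fin 3 → V [⋀^Fin 2]→ₗ[ℝ] ℝ) (a : Fin 3) :
    ∑ d, ∑ c, (1 / 2) * eps a d c *
      innerTwoForm (σ d) (hodgeStar o (innerSL ℝ (b c)).toLinearMap) =
    ∑ d, (1 / 2) * σ d ![b a, b d] := by
  simp only [innerTwoForm_eq_sum b, hodgeStar_orthonormalBasis o b hb]
  have h10 := fun d => twoForm_swap (σ d) (b 1) (b 0)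
  have h20 := fun d => twoForm_swap (σ d) (b 2) (b 0)
  have h21 := fun d => twoForm_swap (σ d) (b 2) (b 1)
  have hii : ∀ d i, σ d ![b i, b i] = 0 := fun d i => by
    linarith [twoForm_swap (σ d) (b i) (b i)]
  -- What remains is `ε_{adc} ε_{cmn} = δ_{am} δ_{dn} - δ_{an} δ_{dm}`, checked componentwise with
  -- the antisymmetry of `σ`.
  obtain rfl | rfl | rfl := fin_three_cases a <;>
    norm_num [Fin.sum_univ_three, eps, h10, h20, h21, hii] <;> ring

end OrthonormalFrames

/-! ### Exterior derivative and curvature in an arbitrary chart. -/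

section ExteriorDerivative

theorem sum_alternatingMap_apply {V N ι κ : Type*} [AddCommGroup V] [Module ℝ V] [AddCommGroup N]
    [Module ℝ N] (s : Finset κ) (f : κ → V [⋀^ι]→ₗ[ℝ] N) (v : ι → V) :
    (∑ k ∈ s, f k) v = ∑ k ∈ s, f k v := by
  classical
  induction s using Finset.induction_on with
  | empty => simp
  | insert k s hk ih => simp [Finset.sum_insert hk, ih]

variable {M : Type*} [TopologicalSpace M] [ChartedSpace E3 M]
  {φ : OpenPartialHomeomorph M E3} {x : M}

theorem contMDiffAt_chart_apply (hφ : φ ∈ IsManifold.maximalAtlas I3 ∞ M)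
    (hx : x ∈ φ.source) (k : Fin 3) : ContMDiffAt I3 𝓘(ℝ) ∞ (fun y => φ y k) x :=
  ((EuclideanSpace.proj k : E3 →L[ℝ] ℝ).contMDiff.contMDiffAt).comp x (contMDiffAt_chart hφ hx)

theorem coordForm_eq_mvfderiv (hφ : φ ∈ IsManifold.maximalAtlas I3 ∞ M)
    (hx : x ∈ φ.source) (k : Fin 3) (v : TangentSpace I3 x) :
    coordForm φ k x v = mvfderiv I3 (fun y => φ y k) x v := by
  have h := mfderiv_comp_apply (I := I3) (I' := I3) (I'' := 𝓘(ℝ)) x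
    (g := (EuclideanSpace.proj k : E3 →L[ℝ] ℝ)) (f := φ)
    ((EuclideanSpace.proj k : E3 →L[ℝ] ℝ).mdifferentiableAt)
    ((contMDiffAt_chart hφ hx).mdifferentiableAt (by simp)) v
  rw [ContinuousLinearMap.mfderiv_eq] at h
  exact h.symm

theorem sum_coordForm_mul_partialD (hφ : φ ∈ IsManifold.maximalAtlas I3 ∞ M)
    (hx : x ∈ φ.source) {f : M → ℝ} (hf : MDifferentiableAt I3 𝓘(ℝ) f x)
    (v : TangentSpace I3 x) :
    ∑ l, partialD φ l f x * coordForm φ l x v = mvfderiv I3 f x v := by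
  conv_rhs => rw [← sum_coordForm_smul_coordVec hφ hx v, map_sum]
  simp only [map_smul, smul_eq_mul, mvfderiv_apply_coordVec hφ hx hf, mul_comm]

variable [IsManifold I3 ∞ M]

/-- In any chart, `dα(∂_i, ∂_j) = ∂_i α_j - ∂_j α_i`. -/
theorem extDer_coordVec (hφ : φ ∈ IsManifold.maximalAtlas I3 ∞ M) (hx : x ∈ φ.source)
    {α : (x : M) → TangentSpace I3 x →L[ℝ] ℝ}
    (hα : ∀ k, ContMDiffAt I3 𝓘(ℝ) ∞ (fun y => α y (coordVec (chartAt E3 x) k y)) x)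
    (i j : Fin 3) :
    extDer α x ![coordVec φ i x, coordVec φ j x] =
      pd i (formComp φ α j) (φ x) - pd j (formComp φ α i) (φ x) := by
  set ψ := chartAt E3 x with hψd
  have hψ : ψ ∈ IsManifold.maximalAtlas I3 ∞ M := IsManifold.chart_mem_maximalAtlas x
  have hxψ : x ∈ ψ.source := mem_chart_source E3 x
  set f : Fin 3 → M → ℝ := fun k y => α y (coordVec ψ k y) with hf
  set g : Fin 3 → M → ℝ := fun k y => ψ y k with hg
  have hfd : ∀ k, MDifferentiableAt I3 𝓘(ℝ) (f k) x := fun k => (hα k).mdifferentiableAt (by simp)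
  have hF : ∀ k, DifferentiableAt ℝ (fun y => f k (φ.symm y)) (φ x) := fun k =>
    (contDiffAt_comp_chart_symm hφ hx (hα k)).differentiableAt (by simp)
  have hG : ∀ k, ContDiffAt ℝ 2 (fun y => g k (φ.symm y)) (φ x) := fun k =>
    (contDiffAt_comp_chart_symm hφ hx (contMDiffAt_chart_apply hψ hxψ k)).of_le
      (WithTop.coe_le_coe.2 le_top)
  have hdg : ∀ {y : M}, y ∈ φ.source → y ∈ ψ.source → ∀ k j,
      coordForm ψ k y (coordVec φ j y) = pd j (fun y => g k (φ.symm y)) (φ y) := by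
    intro y hy hyψ k j
    rw [coordForm_eq_mvfderiv hψ hyψ, mvfderiv_apply_coordVec hφ hy
      ((contMDiffAt_chart_apply hψ hyψ k).mdifferentiableAt (by simp))]
    rfl
  have hdf : ∀ k i, ∑ l, partialD ψ l (f k) x * coordForm ψ l x (coordVec φ i x) =
      pd i (fun y => f k (φ.symm y)) (φ x) := by
    intro k i
    rw [sum_coordForm_mul_partialD hψ hxψ (hfd k), mvfderiv_apply_coordVec hφ hx (hfd k)]
    rfl
  -- `extDer` is computed in the preferred chart `ψ`. Writing `α = f_k dψ^k` gives the
  -- transformation law `α_j = f_k ∂_j ψ^k` for the components in `φ`.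
  have hev : ∀ j, formComp φ α j =ᶠ[𝓝 (φ x)] fun y => ∑ k, f k (φ.symm y) *
      pd j (fun y => g k (φ.symm y)) y := by
    intro j
    have hcont : ∀ᶠ y in 𝓝 (φ x), φ.symm y ∈ ψ.source :=
      (φ.continuousAt_symm (φ.map_source hx)).eventually_mem
        (by rw [φ.left_inv hx]; exact ψ.open_source.mem_nhds hxψ)
    filter_upwards [eventually_mem_target hx, hcont] with y hy hyψ
    have hys := φ.map_target hy
    unfold formComp
    conv_lhs => rw [← sum_coordForm_smul_coordVec hψ hyψ (coordVec φ j (φ.symm y)), map_sum]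
    simp only [map_smul, smul_eq_mul]
    refine Finset.sum_congr rfl fun k _ => ?_
    rw [hdg hys hyψ, φ.right_inv hy, mul_comm]
  have hpd : ∀ i j, pd i (formComp φ α j) (φ x) = ∑ k,
      (pd i (fun y => f k (φ.symm y)) (φ x) * pd j (fun y => g k (φ.symm y)) (φ x) +
        f k (φ.symm (φ x)) * pd i (pd j (fun y => g k (φ.symm y))) (φ x)) := by
    intro i j
    rw [pd_congr (hev j), pd_sum fun k _ => (hF k).fun_mul (differentiableAt_pd (hG k) j)]
    exact Finset.sum_congr rfl fun k _ => pd_mul (hF k) (differentiableAt_pd (hG k) j) i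
  rw [hpd, hpd, ← Finset.sum_sub_distrib]
  have hl : extDer α x ![coordVec φ i x, coordVec φ j x] = ∑ k,
      ((∑ l, partialD ψ l (f k) x * coordForm ψ l x (coordVec φ i x)) *
          coordForm ψ k x (coordVec φ j x) -
        (∑ l, partialD ψ l (f k) x * coordForm ψ l x (coordVec φ j x)) *
          coordForm ψ k x (coordVec φ i x)) := by
    simp only [extDer, sum_alternatingMap_apply, AlternatingMap.smul_apply, wedge_apply,
      smul_eq_mul, ← hψd]
    rw [Finset.sum_comm]
    refine Finset.sum_congr rfl fun k _ => ?_
    rw [Finset.sum_mul, Finset.sum_mul, ← Finset.sum_sub_distrib]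
    refine Finset.sum_congr rfl fun l _ => ?_
    simp only [ContinuousLinearMap.coe_coe, hf]
    ring
  rw [hl]
  refine Finset.sum_congr rfl fun k _ => ?_
  -- The terms `f_k ∂_i ∂_j ψ^k` cancel by symmetry, which is why the exterior derivative is
  -- independent of the chart.
  rw [hdf, hdf, hdg hx hxψ, hdg hx hxψ, pd_comm (hG k) i j]
  ring

/-- The factor `2` comes from the normalisation `F = ½ F^b τ_b`; the `½` in `½ [A ∧ A]` is
compensated by the two terms of the wedge product. -/
theorem curvComp_coordVec (hφ : φ ∈ IsManifold.maximalAtlas I3 ∞ M) (hx : x ∈ φ.source)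
    {A : (x : M) → TangentSpace I3 x →L[ℝ] su2}
    (hA : ∀ a k, ContMDiffAt I3 𝓘(ℝ) ∞ (fun y => comp A a y (coordVec (chartAt E3 x) k y)) x)
    (b i j : Fin 3) :
    curvComp A b x ![coordVec φ i x, coordVec φ j x] = 2 * fieldStrength A φ b i j x := by
  have h1 : su2Coord b (curvature A x ![coordVec φ i x, coordVec φ j x]) =
      fieldStrength A φ b i j x := by
    simp only [curvature, AlternatingMap.add_apply, sum_alternatingMap_apply,
      AlternatingMap.smul_apply, LinearMap.compAlternatingMap_apply,
      LinearMap.toSpanSingleton_apply, map_add, map_sum, map_smul, su2Bracket_tau, su2Coord_tau,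
      extDer_coordVec hφ hx (hA _), wedge_apply, smul_eq_mul, ContinuousLinearMap.coe_coe]
    rw [fieldStrength_eq_frameCurvature A hx, frameCurvature]
    simp only [formComp_chart hx]
    obtain rfl | rfl | rfl := fin_three_cases b <;> norm_num [Fin.sum_univ_three, eps] <;> ring
  rw [← h1]
  rfl

end ExteriorDerivative

/-! ### Raising indices of the extrinsic curvature. -/

section MomentumAlgebra

/-- Here `E` is the coframe, `H` the frame and `K` the matrix `K^a_i`, so `Eᵀ E` is the metric and
`Kᵀ E` the extrinsic curvature. Symmetry of `K H` moves the vector index of the Weingarten map `H K`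
to the first place, the one contracted in the divergence of the momentum. -/
theorem matrix_momentum {n : Type*} [Fintype n] [DecidableEq n] {E H K : Matrix n n ℝ}
    (hHE : H * E = 1) (hs : (K * H).transpose = K * H) :
    (E.transpose * E)⁻¹ = H * H.transpose ∧
      (E.transpose * E)⁻¹ * (K.transpose * E) * (E.transpose * E)⁻¹ = H * K * (H * H.transpose) ∧
      ((E.transpose * E)⁻¹ * (K.transpose * E)).trace = (H * K).trace := by
  have hEH : E * H = 1 := mul_eq_one_comm.1 hHE
  have hHEt : H.transpose * E.transpose = 1 := by
    rw [← Matrix.transpose_mul, hEH, Matrix.transpose_one]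
  have hinv : (E.transpose * E)⁻¹ = H * H.transpose := by
    apply Matrix.inv_eq_left_inv
    rw [mul_assoc, ← mul_assoc H.transpose, hHEt, one_mul, hHE]
  rw [Matrix.transpose_mul] at hs
  refine ⟨hinv, ?_, ?_⟩
  · rw [hinv]
    calc H * H.transpose * (K.transpose * E) * (H * H.transpose)
        = H * (H.transpose * K.transpose) * (E * H) * H.transpose := by simp only [mul_assoc]
      _ = _ := by rw [hs, hEH]; simp only [mul_assoc, one_mul]
  · rw [hinv]
    calc (H * H.transpose * (K.transpose * E)).trace
        = (H * (H.transpose * K.transpose) * E).trace := by simp only [mul_assoc]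
      _ = (E * (H * (K * H))).trace := by rw [hs, Matrix.trace_mul_comm]
      _ = (H * K).trace := by rw [← mul_assoc, hEH, one_mul, Matrix.trace_mul_comm]

end MomentumAlgebra

/-! ### Volume form, diffeomorphism constraint and Gauss constraint in the frame. -/

section Constraints

variable {M : Type*} [TopologicalSpace M] [ChartedSpace E3 M] [IsManifold I3 ∞ M]
  [RiemannianBundle (fun x : M => TangentSpace I3 x)]
  {o : (x : M) → Orientation ℝ (TangentSpace I3 x) (Fin 3)}
  {φ : OpenPartialHomeomorph M E3} {x : M}

theorem vol_frame (e : Dreibein o) (x : M) : vol o x (fun a => e.frame x a) = 1 := by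
  rw [vol, (o x).volumeForm_robust (e.frame x) (e.oriented x)]
  simpa using (e.frame x).toBasis.det_self

theorem vol_ne_zero (e : Dreibein o) (x : M) : vol o x ≠ 0 := by
  intro h
  have h1 := vol_frame e x
  rw [h] at h1
  simp at h1

theorem diffeoConstraint_apply (e : Dreibein o) (A : (x : M) → TangentSpace I3 x →L[ℝ] su2)
    (X : TangentSpace I3 x) :
    diffeoConstraint e A x X = (∑ b, (1 / 2) * curvComp A b x ![X, e.frame x b]) • vol o x := by
  have h : ∀ a, ∑ d, ∑ c, (1 / 2) * eps a d c *
      innerTwoForm (curvComp A d x) (hodgeStar (o x) (coframe e c x).toLinearMap) =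
      ∑ d, (1 / 2) * curvComp A d x ![e.frame x a, e.frame x d] :=
    sum_eps_innerTwoForm_hodgeStar (o x) (e.frame x) (e.oriented x) fun b => curvComp A b x
  have h1 : ∀ b, curvComp A b x ![X, e.frame x b] =
      ∑ a, coframe e a x X * curvComp A b x ![e.frame x a, e.frame x b] := by
    intro b
    rw [← twoFormBilin_apply]
    conv_lhs => rw [← sum_coframe_smul_frame e x X]
    simp only [map_sum, map_smul, LinearMap.sum_apply, LinearMap.smul_apply, smul_eq_mul,
      twoFormBilin_apply]
  have h2 : diffeoConstraint e A x X = ∑ a, (coframe e a x X * ∑ d, ∑ c, (1 / 2) * eps a d c *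
      innerTwoForm (curvComp A d x) (hodgeStar (o x) (coframe e c x).toLinearMap)) • vol o x := by
    simp only [diffeoConstraint, LinearMap.sum_apply, LinearMap.smul_apply,
      LinearMap.smulRight_apply, Finset.mul_sum, Finset.sum_smul, smul_smul,
      ContinuousLinearMap.coe_coe]
    refine Finset.sum_congr rfl fun a _ => Finset.sum_congr rfl fun d _ =>
      Finset.sum_congr rfl fun c _ => ?_
    rw [mul_comm (coframe e a x X)]
  rw [h2, ← Finset.sum_smul]
  congr 1
  simp only [h, h1, Finset.mul_sum]
  rw [Finset.sum_comm]
  exact Finset.sum_congr rfl fun d _ => Finset.sum_congr rfl fun a _ => by ring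

theorem det_coframeComp (e : Dreibein o) (hx : x ∈ φ.source) :
    (Matrix.of fun b i => coframeComp e φ b i (φ x)).det =
      vol o x (fun i => coordVec φ i x) := by
  rw [vol, (o x).volumeForm_robust (e.frame x) (e.oriented x), Basis.det_apply]
  congr 1
  ext b i
  rw [Basis.toMatrix_apply, OrthonormalBasis.coe_toBasis_repr_apply,
    OrthonormalBasis.repr_apply_apply, Matrix.of_apply, coframeComp, formComp_chart hx]
  rfl

theorem metricMatrix_eq (e : Dreibein o) (hx : x ∈ φ.source) :
    metricMatrix φ x = (Matrix.of fun b i => coframeComp e φ b i (φ x)).transpose *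
      (Matrix.of fun b i => coframeComp e φ b i (φ x)) := by
  ext i j
  simp only [metricMatrix, Matrix.of_apply, Matrix.mul_apply, Matrix.transpose_apply, coframeComp,
    formComp_chart hx]
  rw [← (e.frame x).sum_inner_mul_inner]
  simp only [coframe, innerSL_apply_apply, real_inner_comm]

theorem sqrtQ_eq (e : Dreibein o) (hx : x ∈ φ.source) :
    sqrtQ φ x = |(Matrix.of fun b i => coframeComp e φ b i (φ x)).det| := by
  rw [sqrtQ, metricMatrix_eq e hx, Matrix.det_mul, Matrix.det_transpose, Real.sqrt_mul_self_eq_abs]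

theorem coordVol_frame (e : Dreibein o) (hx : x ∈ φ.source) :
    coordVol φ x (fun a => e.frame x a) =
      (Matrix.of fun i b => frameComp e φ b i (φ x)).det := by
  rw [← Matrix.det_transpose]
  change Matrix.det (fun a => LinearMap.pi (fun i => (coordForm φ i x).toLinearMap)
    (e.frame x a)) = _
  congr 1
  ext a i
  simp [frameComp_chart e hx]

/-- Top-degree forms are determined by their value on one basis, here the frame. Positive
orientation removes the absolute value in `√q = |det e|`. -/
theorem vol_eq_sqrtQ_smul_coordVol (e : Dreibein o) (hφ : φ ∈ IsManifold.maximalAtlas I3 ∞ M)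
    (hx : x ∈ φ.source) (hpos : 0 < vol o x (fun i => coordVec φ i x)) :
    vol o x = sqrtQ φ x • coordVol φ x := by
  have h1 : (Matrix.of fun i b => frameComp e φ b i (φ x)) *
      (Matrix.of fun b i => coframeComp e φ b i (φ x)) = 1 := by
    ext i j
    simpa [Matrix.mul_apply, Matrix.one_apply] using
      sum_frameComp_mul_coframeComp e hφ (φ.map_source hx) i j
  have h2 : sqrtQ φ x * coordVol φ x (fun a => e.frame x a) = 1 := by
    rw [sqrtQ_eq e hx, det_coframeComp e hx, abs_of_pos hpos, ← det_coframeComp e hx,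
      coordVol_frame e hx, mul_comm, ← Matrix.det_mul, h1, Matrix.det_one]
  rw [(vol o x).eq_smul_basis_det (e.frame x).toBasis,
    (coordVol φ x).eq_smul_basis_det (e.frame x).toBasis, smul_smul]
  congr 1
  rw [OrthonormalBasis.coe_toBasis]
  exact (vol_frame e x).trans h2.symm

/-- The trace in the orthonormal frame picks out the coefficients of `∇e_a` and `De_a`, leaving the
antisymmetric part of `Γ - A`. -/
theorem gaussConstraint_eq (e : Dreibein o)
    [IsContMDiffRiemannianBundle I3 ∞ E3 (fun x : M => TangentSpace I3 x)]
    (A : (x : M) → TangentSpace I3 x →L[ℝ] su2) (a : Fin 3) (x : M) :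
    gaussConstraint e A a x = (∑ c, ∑ b, eps b a c *
      (comp (spinConnection e) b x (e.frame x c) - comp A b x (e.frame x c))) • vol o x := by
  have h : ∀ B : (x : M) → TangentSpace I3 x →L[ℝ] su2,
      LinearMap.trace ℝ (TangentSpace I3 x)
        (inducedCov e B (fun y => e.frame y a) x).toLinearMap =
      ∑ c, ∑ b, eps b a c * comp B b x (e.frame x c) := by
    intro B
    rw [LinearMap.trace_eq_sum_inner _ (e.frame x)]
    refine Finset.sum_congr rfl fun c _ => ?_
    rw [ContinuousLinearMap.coe_coe, inducedCov_frame]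
    simp only [inner_sum, inner_smul_right, orthonormal_iff_ite.1 (e.frame x).orthonormal]
    simp
  rw [gaussConstraint, divDens, divDens, leviCivita, h, h]
  refine (sub_smul _ _ _).symm.trans ?_
  simp only [mul_sub, Finset.sum_sub_distrib]

/-- The Gauss constraint says that `A - Γ` is symmetric. -/
theorem symmetric_of_gaussConstraint_eq_zero (e : Dreibein o)
    [IsContMDiffRiemannianBundle I3 ∞ E3 (fun x : M => TangentSpace I3 x)]
    (A : (x : M) → TangentSpace I3 x →L[ℝ] su2) (hG : ∀ a, gaussConstraint e A a x = 0)
    (a b : Fin 3) :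
    (comp A a x - comp (spinConnection e) a x) (e.frame x b) =
      (comp A b x - comp (spinConnection e) b x) (e.frame x a) := by
  have h : ∀ a, ∑ c, ∑ b, eps b a c *
      (comp (spinConnection e) b x (e.frame x c) - comp A b x (e.frame x c)) = 0 := by
    intro a
    have h1 := hG a
    rw [gaussConstraint_eq] at h1
    exact (smul_eq_zero.1 h1).resolve_right (vol_ne_zero e x)
  have h0 := h 0
  have h1 := h 1
  have h2 := h 2
  simp only [_root_.sub_apply]
  norm_num [Fin.sum_univ_three, eps] at h0 h1 h2
  obtain rfl | rfl | rfl := fin_three_cases a <;> obtain rfl | rfl | rfl := fin_three_cases b <;>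
    linarith

end Constraints

/-! ### The Weingarten map, and the comparison of the three constraints. -/

section Main

variable {M : Type*} [TopologicalSpace M] [ChartedSpace E3 M] [IsManifold I3 ∞ M]
  [RiemannianBundle (fun x : M => TangentSpace I3 x)]
  {o : (x : M) → Orientation ℝ (TangentSpace I3 x) (Fin 3)}
  {φ : OpenPartialHomeomorph M E3} {x : M}

/-- The 1-forms `K^a = β⁻¹ (A^a - Γ^a)`. -/
def weingartenForm (e : Dreibein o) (A : (x : M) → TangentSpace I3 x →L[ℝ] su2) (β : ℝ)
    (a : Fin 3) (x : M) : TangentSpace I3 x →L[ℝ] ℝ :=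
  β⁻¹ • (comp A a x - comp (spinConnection e) a x)

/-- The components `W_i^j` of the Weingarten map in the chart `φ`, as functions on `ℝ³`. -/
def weingartenComp (e : Dreibein o) (A : (x : M) → TangentSpace I3 x →L[ℝ] su2) (β : ℝ)
    (φ : OpenPartialHomeomorph M E3) (i j : Fin 3) (u : E3) : ℝ :=
  endComp (weingarten e A β) φ i j (φ.symm u)

theorem weingartenComp_eq (e : Dreibein o) (A : (x : M) → TangentSpace I3 x →L[ℝ] su2) (β : ℝ)
    (φ : OpenPartialHomeomorph M E3) (i j : Fin 3) (u : E3) :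
    weingartenComp e A β φ i j u =
      ∑ a, formComp φ (weingartenForm e A β a) i u * frameComp e φ a j u := by
  simp only [weingartenComp, endComp, weingarten, _root_.sum_apply,
    ContinuousLinearMap.smulRight_apply, map_sum, map_smul, smul_eq_mul]
  rfl

theorem endComp_weingarten (e : Dreibein o) (A : (x : M) → TangentSpace I3 x →L[ℝ] su2) (β : ℝ)
    (hx : x ∈ φ.source) (i j : Fin 3) :
    endComp (weingarten e A β) φ i j x = weingartenComp e A β φ i j (φ x) :=
  congrArg (endComp (weingarten e A β) φ i j) (φ.left_inv hx).symm

theorem weingartenForm_eq_sum (e : Dreibein o) (A : (x : M) → TangentSpace I3 x →L[ℝ] su2)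
    (β : ℝ) (hφ : φ ∈ IsManifold.maximalAtlas I3 ∞ M) {u : E3} (hu : u ∈ φ.target) (b j : Fin 3) :
    formComp φ (weingartenForm e A β b) j u =
      ∑ l, weingartenComp e A β φ j l u * coframeComp e φ b l u := by
  calc formComp φ (weingartenForm e A β b) j u
      = ∑ a, formComp φ (weingartenForm e A β a) j u *
          ∑ l, frameComp e φ a l u * coframeComp e φ b l u := by
        simp [sum_frameComp_mul_coframeComp' e hφ hu]
    _ = _ := by
        simp only [weingartenComp_eq, Finset.mul_sum, Finset.sum_mul, mul_assoc]
        exact Finset.sum_comm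

theorem formComp_connection (e : Dreibein o) (A : (x : M) → TangentSpace I3 x →L[ℝ] su2) {β : ℝ}
    (hβ : β ≠ 0) (a i : Fin 3) (u : E3) :
    formComp φ (comp A a) i u = formComp φ (comp (spinConnection e) a) i u +
      β * formComp φ (weingartenForm e A β a) i u := by
  simp only [formComp, weingartenForm, _root_.smul_apply, _root_.sub_apply, smul_eq_mul]
  rw [mul_inv_cancel_left₀ hβ]
  ring

variable [IsContMDiffRiemannianBundle I3 ∞ E3 (fun x : M => TangentSpace I3 x)]

theorem contractedCodazzi_eq_frameCodazzi (e : Dreibein o)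
    (A : (x : M) → TangentSpace I3 x →L[ℝ] su2) (β : ℝ) (hx : x ∈ φ.source) (i : Fin 3) :
    contractedCodazzi e (weingarten e A β) φ i x =
      frameCodazzi (fun k i j => christoffel e φ k i j x) (weingartenComp e A β φ) i (φ x) := by
  simp only [contractedCodazzi, frameCodazzi, endComp_weingarten e A β hx]
  rfl

theorem diffeoConstraint_coordVec (e : Dreibein o) {A : (x : M) → TangentSpace I3 x →L[ℝ] su2}
    (hA : ∀ a c, ContMDiff I3 𝓘(ℝ) ∞ fun y => comp A a y (e.frame y c))
    (hφ : φ ∈ IsManifold.maximalAtlas I3 ∞ M) (hx : x ∈ φ.source) (i : Fin 3) :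
    diffeoConstraint e A x (coordVec φ i x) =
      (∑ b, ∑ j, coordForm φ j x (e.frame x b) * fieldStrength A φ b i j x) • vol o x := by
  rw [diffeoConstraint_apply]
  congr 1
  refine Finset.sum_congr rfl fun b _ => ?_
  have hA' : ∀ a k, ContMDiffAt I3 𝓘(ℝ) ∞
      (fun y => comp A a y (coordVec (chartAt E3 x) k y)) x := fun a k =>
    contMDiffAt_form_coordVec e (IsManifold.chart_mem_maximalAtlas x) (mem_chart_source E3 x)
      (hA a) k
  rw [← twoFormBilin_apply]
  conv_lhs => rw [← sum_coordForm_smul_coordVec hφ hx (e.frame x b)]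
  simp only [map_sum, map_smul, twoFormBilin_apply, smul_eq_mul, curvComp_coordVec hφ hx hA',
    Finset.mul_sum]
  exact Finset.sum_congr rfl fun j _ => by ring

/-- The coordinate vectors span the tangent space and the volume form is nonzero, so only the scalar
coefficients matter. -/
theorem diffeoConstraint_eq_zero_iff (e : Dreibein o)
    {A : (x : M) → TangentSpace I3 x →L[ℝ] su2}
    (hA : ∀ a c, ContMDiff I3 𝓘(ℝ) ∞ fun y => comp A a y (e.frame y c))
    (hφ : φ ∈ IsManifold.maximalAtlas I3 ∞ M) (hx : x ∈ φ.source) :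
    diffeoConstraint e A x = 0 ↔ ∀ i, ∑ b, ∑ j, frameComp e φ b j (φ x) *
      frameCurvature (fun a i => formComp φ (comp A a) i) b i j (φ x) = 0 := by
  have h1 : ∀ i, diffeoConstraint e A x (coordVec φ i x) =
      (∑ b, ∑ j, frameComp e φ b j (φ x) *
        frameCurvature (fun a i => formComp φ (comp A a) i) b i j (φ x)) • vol o x := by
    intro i
    rw [diffeoConstraint_coordVec e hA hφ hx]
    simp only [fieldStrength_eq_frameCurvature A hx, frameComp_chart e hx]
  constructor
  · intro h i
    have h2 := h1 i
    rw [h, LinearMap.zero_apply] at h2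
    exact (smul_eq_zero.1 h2.symm).resolve_right (vol_ne_zero e x)
  · intro h
    refine LinearMap.ext fun X => ?_
    rw [← sum_coordForm_smul_coordVec hφ hx X, map_sum]
    simp only [map_smul, h1, h, zero_smul, smul_zero, Finset.sum_const_zero, LinearMap.zero_apply]

theorem differentiableAt_formComp (e : Dreibein o) (hφ : φ ∈ IsManifold.maximalAtlas I3 ∞ M)
    (hx : x ∈ φ.source) {α : (x : M) → TangentSpace I3 x →L[ℝ] ℝ}
    (hα : ∀ a, ContMDiff I3 𝓘(ℝ) ∞ fun y => α y (e.frame y a)) (i : Fin 3) :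
    DifferentiableAt ℝ (formComp φ α i) (φ x) :=
  (contDiffAt_formComp e hφ hx hα i).differentiableAt (by simp)

theorem contDiffAt_two_coframeComp (e : Dreibein o) (hφ : φ ∈ IsManifold.maximalAtlas I3 ∞ M)
    (hx : x ∈ φ.source) (a i : Fin 3) : ContDiffAt ℝ 2 (coframeComp e φ a i) (φ x) :=
  (contDiffAt_coframeComp e hφ hx a i).of_le (WithTop.coe_le_coe.2 le_top)

/-- A torsion-free connection satisfies the diffeomorphism constraint. -/
theorem diffeoConstraint_eq_zero_of_torsion_eq_zero (e : Dreibein o)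
    {A : (x : M) → TangentSpace I3 x →L[ℝ] su2}
    (hA : ∀ a c, ContMDiff I3 𝓘(ℝ) ∞ fun y => comp A a y (e.frame y c))
    (hT : (inducedCov e A).torsion = 0) (x : M) : diffeoConstraint e A x = 0 := by
  have hφ : chartAt E3 x ∈ IsManifold.maximalAtlas I3 ∞ M := IsManifold.chart_mem_maximalAtlas x
  have hx := mem_chart_source E3 x
  rw [diffeoConstraint_eq_zero_iff e hA hφ hx]
  exact contracted_frameCurvature_eq_zero (contDiffAt_two_coframeComp e hφ hx)
    (fun a i => differentiableAt_formComp e hφ hx (hA a) i)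
    ((eventually_mem_target hx).mono fun y hy c i j => frameTorsion_eq_zero e A hφ hT hy c i j)
    (sum_frameComp_mul_coframeComp e hφ ((chartAt E3 x).map_source hx))

theorem contMDiff_weingartenForm (e : Dreibein o) {A : (x : M) → TangentSpace I3 x →L[ℝ] su2}
    (hA : ∀ a c, ContMDiff I3 𝓘(ℝ) ∞ fun y => comp A a y (e.frame y c)) (β : ℝ) (a c : Fin 3) :
    ContMDiff I3 𝓘(ℝ) ∞ fun y => weingartenForm e A β a y (e.frame y c) :=
  contMDiff_const.mul ((hA a c).sub (contMDiff_spinConnection_frame e a c))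

theorem differentiableAt_weingartenComp (e : Dreibein o)
    {A : (x : M) → TangentSpace I3 x →L[ℝ] su2}
    (hA : ∀ a c, ContMDiff I3 𝓘(ℝ) ∞ fun y => comp A a y (e.frame y c)) (β : ℝ)
    (hφ : φ ∈ IsManifold.maximalAtlas I3 ∞ M) (hx : x ∈ φ.source) (i j : Fin 3) :
    DifferentiableAt ℝ (weingartenComp e A β φ i j) (φ x) := by
  have h : weingartenComp e A β φ i j = fun u =>
      ∑ a, formComp φ (weingartenForm e A β a) i u * frameComp e φ a j u :=
    funext fun u => weingartenComp_eq e A β φ i j u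
  rw [h]
  exact DifferentiableAt.fun_sum fun a _ =>
    (differentiableAt_formComp e hφ hx (contMDiff_weingartenForm e hA β a) i).mul
      (differentiableAt_frameComp e hφ hx a j)

/-- On the Gauss constraint surface, `K^a(e_b)` is symmetric. -/
theorem weingartenForm_symm (e : Dreibein o) {A : (x : M) → TangentSpace I3 x →L[ℝ] su2}
    (hG : ∀ a x, gaussConstraint e A a x = 0) (β : ℝ)
    (hφ : φ ∈ IsManifold.maximalAtlas I3 ∞ M) {u : E3} (hu : u ∈ φ.target) (a b : Fin 3) :
    ∑ j, frameComp e φ b j u * formComp φ (weingartenForm e A β a) j u =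
      ∑ j, frameComp e φ a j u * formComp φ (weingartenForm e A β b) j u := by
  have hx := φ.map_target hu
  have h := fun a b => sum_frameComp_mul_formComp e hφ hx (weingartenForm e A β a) b
  simp only [φ.right_inv hu] at h
  rw [h, h]
  exact congrArg (fun r : ℝ => β⁻¹ * r)
    (symmetric_of_gaussConstraint_eq_zero e A (fun a => hG a _) a b)

/-- On the Gauss constraint surface, the diffeomorphism constraint is `β` times the contracted
Codazzi expression. -/
theorem diffeoConstraint_eq_zero_iff_codazzi (e : Dreibein o)
    {A : (x : M) → TangentSpace I3 x →L[ℝ] su2}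
    (hA : ∀ a c, ContMDiff I3 𝓘(ℝ) ∞ fun y => comp A a y (e.frame y c)) {β : ℝ} (hβ : β ≠ 0)
    (hG : ∀ a x, gaussConstraint e A a x = 0)
    (hφ : φ ∈ IsManifold.maximalAtlas I3 ∞ M) (hx : x ∈ φ.source) :
    diffeoConstraint e A x = 0 ↔ ∀ i, contractedCodazzi e (weingarten e A β) φ i x = 0 := by
  rw [diffeoConstraint_eq_zero_iff e hA hφ hx]
  refine forall_congr' fun i => ?_
  have hu := φ.map_source hx
  have h := contracted_frameCurvature_add (e := fun a i => coframeComp e φ a i)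
    (h := frameComp e φ) (Γ := fun a i => formComp φ (comp (spinConnection e) a) i)
    (K := fun a i => formComp φ (weingartenForm e A β a) i) (W := weingartenComp e A β φ)
    (C := fun k i j => christoffel e φ k i j x) (u := φ x)
    (A := fun a i => formComp φ (comp A a) i) (β := β)
    (contDiffAt_two_coframeComp e hφ hx)
    (fun a i => differentiableAt_formComp e hφ hx (contMDiff_spinConnection_frame e a) i)
    (fun a i => differentiableAt_formComp e hφ hx (contMDiff_weingartenForm e hA β a) i)
    (differentiableAt_weingartenComp e hA β hφ hx)
    (sum_frameComp_mul_coframeComp e hφ hu)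
    ((eventually_mem_target hx).mono fun y hy c i j =>
      frameTorsion_eq_zero e _ hφ (leviCivita_torsion e) hy c i j)
    ((eventually_mem_target hx).mono fun y hy b j => weingartenForm_eq_sum e A β hφ hy b j)
    (sum_coframeComp_mul_christoffel e hφ hx)
    (fun a i y => formComp_connection e A hβ a i y)
    (fun a b => weingartenForm_symm e hG β hφ hu a b) i
  rw [h, ← contractedCodazzi_eq_frameCodazzi e A β hx, mul_eq_zero, or_iff_right hβ]

omit [IsContMDiffRiemannianBundle I3 ∞ E3 (fun x : M => TangentSpace I3 x)] in
theorem extrinsic_eq (e : Dreibein o) (A : (x : M) → TangentSpace I3 x →L[ℝ] su2) (β : ℝ)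
    (hx : x ∈ φ.source) :
    extrinsic (weingarten e A β) φ x =
      (Matrix.of fun a i => formComp φ (weingartenForm e A β a) i (φ x)).transpose *
        (Matrix.of fun b i => coframeComp e φ b i (φ x)) := by
  ext i j
  simp only [extrinsic, weingarten, Matrix.of_apply, Matrix.mul_apply, Matrix.transpose_apply,
    coframeComp, formComp_chart hx, _root_.sum_apply, ContinuousLinearMap.smulRight_apply,
    sum_inner, real_inner_smul_left]
  rfl

/-- Expresses the momentum through `W` and the inverse metric, the form in which its divergence is
computed. The Gauss constraint enters because `K_{ij}` has to be symmetric for `K^{mj} = q^{lj}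
W_l^m`. -/
theorem admMomentum_eq (e : Dreibein o) {A : (x : M) → TangentSpace I3 x →L[ℝ] su2}
    (hG : ∀ a x, gaussConstraint e A a x = 0) (β k : ℝ)
    (hφ : φ ∈ IsManifold.maximalAtlas I3 ∞ M) (hx : x ∈ φ.source) (m j : Fin 3) :
    admMomentum (weingarten e A β) k φ m j x = k⁻¹ * (sqrtQ φ x *
      (∑ l, inverseMetric (frameComp e φ) l j (φ x) * weingartenComp e A β φ l m (φ x) -
        inverseMetric (frameComp e φ) m j (φ x) * ∑ l, weingartenComp e A β φ l l (φ x))) := by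
  have hu := φ.map_source hx
  have hHE : (Matrix.of fun i b => frameComp e φ b i (φ x)) *
      (Matrix.of fun b i => coframeComp e φ b i (φ x)) = 1 := by
    ext i j
    simpa [Matrix.mul_apply, Matrix.one_apply] using sum_frameComp_mul_coframeComp e hφ hu i j
  have hs : ((Matrix.of fun a i => formComp φ (weingartenForm e A β a) i (φ x)) *
      (Matrix.of fun i b => frameComp e φ b i (φ x))).transpose =
      (Matrix.of fun a i => formComp φ (weingartenForm e A β a) i (φ x)) *
      (Matrix.of fun i b => frameComp e φ b i (φ x)) := by
    ext a b
    simpa [Matrix.mul_apply, mul_comm] using weingartenForm_symm e hG β hφ hu b a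
  obtain ⟨h1, h2, h3⟩ := matrix_momentum hHE hs
  rw [admMomentum, metricMatrix_eq e hx, extrinsic_eq e A β hx, h2, h3, h1]
  have hHK : ∀ m l, ((Matrix.of fun i b => frameComp e φ b i (φ x)) *
      (Matrix.of fun a i => formComp φ (weingartenForm e A β a) i (φ x))) m l =
      weingartenComp e A β φ l m (φ x) := by
    intro m l
    rw [weingartenComp_eq, Matrix.mul_apply]
    exact Finset.sum_congr rfl fun a _ =>
      mul_comm (frameComp e φ a m (φ x)) (formComp φ (weingartenForm e A β a) l (φ x))
  have hq : ∀ l j, ((Matrix.of fun i b => frameComp e φ b i (φ x)) *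
      (Matrix.of fun i b => frameComp e φ b i (φ x)).transpose) l j =
      inverseMetric (frameComp e φ) l j (φ x) := fun l j => rfl
  rw [Matrix.mul_apply, Matrix.trace, hq]
  simp only [Matrix.diag_apply, hHK, hq]
  rw [div_eq_mul_inv, mul_comm (sqrtQ φ x), mul_assoc]
  simp only [mul_comm (weingartenComp e A β φ _ m _)]

omit [IsContMDiffRiemannianBundle I3 ∞ E3 (fun x : M => TangentSpace I3 x)] in
theorem sum_metricMatrix_mul_inverseMetric (e : Dreibein o)
    (hφ : φ ∈ IsManifold.maximalAtlas I3 ∞ M) (hx : x ∈ φ.source) (i l : Fin 3) :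
    ∑ j, metricMatrix φ x i j * inverseMetric (frameComp e φ) l j (φ x) =
      if i = l then 1 else 0 := by
  have hHE : (Matrix.of fun i b => frameComp e φ b i (φ x)) *
      (Matrix.of fun b i => coframeComp e φ b i (φ x)) = 1 := by
    ext i j
    simpa [Matrix.mul_apply, Matrix.one_apply] using
      sum_frameComp_mul_coframeComp e hφ (φ.map_source hx) i j
  have hEH := mul_eq_one_comm.1 hHE
  have h : metricMatrix φ x * ((Matrix.of fun i b => frameComp e φ b i (φ x)) *
      (Matrix.of fun i b => frameComp e φ b i (φ x)).transpose) = 1 := by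
    rw [metricMatrix_eq e hx, mul_assoc, ← mul_assoc (Matrix.of fun b i => _), hEH, one_mul,
      ← Matrix.transpose_mul, hHE, Matrix.transpose_one]
  rw [← Matrix.one_apply, ← h, Matrix.mul_apply]
  refine Finset.sum_congr rfl fun j _ => ?_
  congr 1
  exact Finset.sum_congr rfl fun a _ => mul_comm _ _

/-- On the Gauss constraint surface, the supermomentum is a nonzero multiple of the contracted
Codazzi expression. -/
theorem supermomentum_eq (e : Dreibein o) {A : (x : M) → TangentSpace I3 x →L[ℝ] su2}
    (hA : ∀ a c, ContMDiff I3 𝓘(ℝ) ∞ fun y => comp A a y (e.frame y c))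
    (hG : ∀ a x, gaussConstraint e A a x = 0) (β k : ℝ)
    (hφ : φ ∈ IsManifold.maximalAtlas I3 ∞ M) (hx : x ∈ φ.source) (i : Fin 3) :
    sqrtQ φ x ≠ 0 ∧ supermomentum e (weingarten e A β) k φ i x =
      2 * (k⁻¹ * sqrtQ φ x) * contractedCodazzi e (weingarten e A β) φ i x := by
  have hu := φ.map_source hx
  have he : ∀ a i, DifferentiableAt ℝ (coframeComp e φ a i) (φ x) := fun a i =>
    (contDiffAt_two_coframeComp e hφ hx a i).differentiableAt (by norm_num)
  have hh := differentiableAt_frameComp e hφ hx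
  have hhe := sum_frameComp_mul_coframeComp e hφ hu
  have hC := sum_coframeComp_mul_christoffel e hφ hx
  have hs : ∀ᶠ y in 𝓝 (φ x), sqrtQ φ (φ.symm y) =
      |(Matrix.of fun b i => coframeComp e φ b i y).det| := by
    filter_upwards [eventually_mem_target hx] with y hy
    rw [sqrtQ_eq e (φ.map_target hy), φ.right_inv hy]
  have hsx : sqrtQ φ (φ.symm (φ x)) = sqrtQ φ x := by rw [φ.left_inv hx]
  have hdet := pd_abs_det_coframe (e := fun a i => coframeComp e φ a i) (h := frameComp e φ)
    (C := fun k i j => christoffel e φ k i j x)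
    (Γ := fun a i => formComp φ (comp (spinConnection e) a) i) he hhe
    (sum_frameComp_mul_coframeComp' e hφ hu) hC hs
  refine ⟨hsx ▸ (hdet 0).2.1, ?_⟩
  have hpdh := pd_frame (e := fun a i => coframeComp e φ a i) (h := frameComp e φ)
    (C := fun k i j => christoffel e φ k i j x)
    (Γ := fun a i => formComp φ (comp (spinConnection e) a) i) he hh hhe
    ((eventually_mem_target hx).mono fun y hy => sum_frameComp_mul_coframeComp' e hφ hy) hC
  have hdiv := divergence_momentum (W := weingartenComp e A β φ)
    (C := fun k i j => christoffel e φ k i j x) (u := φ x)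
    (s := fun y => sqrtQ φ (φ.symm y)) (q := inverseMetric (frameComp e φ))
    (P := fun m j y => admMomentum (weingarten e A β) k φ m j (φ.symm y)) k⁻¹
    (differentiableAt_weingartenComp e hA β hφ hx)
    (fun i j => DifferentiableAt.fun_sum fun a _ => (hh a i).mul (hh a j)) (hdet 0).1
    (christoffel_symm e hφ hx) (pd_inverseMetric hh hpdh) (fun m => (hdet m).2.2)
    -- The momentum gets differentiated, so its formula, and with it the Gauss constraint, is needed
    -- on a neighbourhood of the point.
    ((eventually_mem_target hx).mono fun y hy m j => by
      rw [admMomentum_eq e hG β k hφ (φ.map_target hy), φ.right_inv hy])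
  have hd : ∀ j, divDensity e φ (admMomentum (weingarten e A β) k φ) j x =
      -(k⁻¹ * sqrtQ φ x) * ∑ l, inverseMetric (frameComp e φ) l j (φ x) *
        contractedCodazzi e (weingarten e A β) φ l x := by
    intro j
    have h := hdiv j
    simp only [hsx, ← contractedCodazzi_eq_frameCodazzi e A β hx] at h
    rw [← h]
    have hP : ∀ m j, admMomentum (weingarten e A β) k φ m j (φ.symm (φ x)) =
        admMomentum (weingarten e A β) k φ m j x := fun m j =>
      congrArg (admMomentum (weingarten e A β) k φ m j) (φ.left_inv hx)
    simp only [hP]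
    rfl
  -- Lowering the index with the metric undoes the inverse metric in the divergence.
  have hsum : ∑ j, metricMatrix φ x i j * ∑ l, inverseMetric (frameComp e φ) l j (φ x) *
      contractedCodazzi e (weingarten e A β) φ l x =
      contractedCodazzi e (weingarten e A β) φ i x := by
    calc _ = ∑ l, (∑ j, metricMatrix φ x i j * inverseMetric (frameComp e φ) l j (φ x)) *
          contractedCodazzi e (weingarten e A β) φ l x := by
          simp only [Finset.mul_sum, Finset.sum_mul, mul_assoc]
          exact Finset.sum_comm
      _ = _ := by simp [sum_metricMatrix_mul_inverseMetric e hφ hx]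
  rw [supermomentum]
  simp only [hd, mul_left_comm (metricMatrix φ x i _), ← Finset.mul_sum, hsum]
  ring

end Main

end Ashtekar

end

theorem mainTheorem2 {M : Type*} [TopologicalSpace M] [ChartedSpace Ashtekar.E3 M]
    [IsManifold Ashtekar.I3 ∞ M]
    [Bundle.RiemannianBundle (fun x : M => TangentSpace Ashtekar.I3 x)]
    [IsContMDiffRiemannianBundle Ashtekar.I3 ∞ Ashtekar.E3
      (fun x : M => TangentSpace Ashtekar.I3 x)]
    {o : (x : M) → Orientation ℝ (TangentSpace Ashtekar.I3 x) (Fin 3)}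
    (e : Ashtekar.Dreibein o) (A : Ashtekar.AshtekarConnection M)
    (β k : ℝ) (hβ : β ≠ 0) (hk : k ≠ 0) :
    -- in positively oriented coordinates, `𝒱(∂_i) = E^j_b F^b_{ij} dx¹ ∧ dx² ∧ dx³`
    (∀ φ ∈ IsManifold.maximalAtlas Ashtekar.I3 ∞ M, ∀ x ∈ φ.source,
      0 < Ashtekar.vol o x (fun i => Ashtekar.coordVec φ i x) →
      ∀ i, Ashtekar.diffeoConstraint e A.toFun x (Ashtekar.coordVec φ i x) =
        (∑ b, ∑ j, Ashtekar.densDreibein e φ j b x *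
          Ashtekar.fieldStrength A.toFun φ b i j x) • Ashtekar.coordVol φ x) ∧
    -- torsion-free connections satisfy the constraint
    ((Ashtekar.inducedCov e A.toFun).torsion = 0 →
      ∀ x, Ashtekar.diffeoConstraint e A.toFun x = 0) ∧
    -- on the Gauss surface it is the contracted Codazzi equation and the supermomentum constraint
    ((∀ a x, Ashtekar.gaussConstraint e A.toFun a x = 0) →
      ∀ φ ∈ IsManifold.maximalAtlas Ashtekar.I3 ∞ M, ∀ x ∈ φ.source,
        (Ashtekar.diffeoConstraint e A.toFun x = 0 ↔
          ∀ i, Ashtekar.contractedCodazzi e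
            (Ashtekar.weingarten e A.toFun β) φ i x = 0) ∧
        (Ashtekar.diffeoConstraint e A.toFun x = 0 ↔
          ∀ i, Ashtekar.supermomentum e
            (Ashtekar.weingarten e A.toFun β) k φ i x = 0)) := by
  have hA : ∀ a c, ContMDiff Ashtekar.I3 𝓘(ℝ) ∞
      fun y => Ashtekar.comp A.toFun a y (e.frame y c) := fun a c => A.smooth a _ (e.smooth c)
  refine ⟨fun φ hφ x hx hpos i => ?_,
    fun hT x => Ashtekar.diffeoConstraint_eq_zero_of_torsion_eq_zero e hA hT x,
    fun hG φ hφ x hx => ?_⟩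
  · rw [Ashtekar.diffeoConstraint_coordVec e hA hφ hx,
      Ashtekar.vol_eq_sqrtQ_smul_coordVol e hφ hx hpos, smul_smul]
    congr 1
    simp only [Ashtekar.densDreibein, Finset.sum_mul]
    refine Finset.sum_congr rfl fun b _ => Finset.sum_congr rfl fun j _ => ?_
    ring
  · have hC := Ashtekar.diffeoConstraint_eq_zero_iff_codazzi e hA hβ hG hφ hx
    refine ⟨hC, hC.trans (forall_congr' fun i => ?_)⟩
    obtain ⟨hs, hH⟩ := Ashtekar.supermomentum_eq e hA hG β k hφ hx i
    -- The factor `2 k⁻¹ √q` is nonzero.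
    rw [hH, mul_eq_zero, or_iff_right (by simp [hs, hk])]
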